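/- Let $c,d>0$ and $0<\rho<1$, and put $\mathcal V_0=8e\,c^2d\,(2-\rho)/(1-\rho)^3$, $\delta_0=2c/(1-\rho)$. Let $M\ge 1$, let $\|\cdot\|$ be the Euclidean norm on $\mathbb R^M$, and for $1\le r\le M$ let $\mathcal M(\rho,r)$ be the set of real $M\times M$ matrices $Q$ with $\operatorname{rank}Q\le r$ and largest singular value $\|Q\|_{S_\infty}\le\rho$. Let $(X_t)_{t\ge1}$ be a strictly stationary $\mathbb R^M$-valued process with $X_t=AX_{t-1}+\xi_t$ for $t\ge2$, where $A\in\mathcal M(\rho,r_0)$ for some $1\le r_0\le M$, the $(\xi_t)_{t\ge 2}$ are i.i.d., centered and independent of $X_1$, and $\mathbb E\exp(|\xi_t^{(j)}|/c)\le d$ for $j=1,\dots,M$. Let $\ell:\mathbb R^M\to\mathbb R$ be $L$-Lipschitz for some $L\le1$, and assume $n\ge 1+16\,\delta_0^2\,Mr\log(9rn)/\mathcal V_0$ for at least one $r\in\{1,\dots,M\}$. Define $$R(Q)=\mathbb E\,\ell(X_t-QX_{t-1}),\qquad R_n(Q)=\frac1{n-1}\sum_{i=2}^n\ell(X_i-QX_{i-1}),$$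 let $\hat A_r$ be any minimizer of $R_n$ over $\mathcal M(\rho,r)$, let $\bar r=\bar r(M,n)$ be the largest integer $1\le r\le M$ with $n\ge1+16\,\delta_0^2\,r\log(9rn)/\mathcal V_0$, and let the rank-penalized estimator be $\hat A=\hat A_{\hat r}$, where $\hat r$ is any minimizer over $r\in\{1,\dots,\bar r\}$ of $$R_n(\hat A_r)+2(1+\rho)\sqrt{\frac{4\mathcal V_0M^2r\log(9rn)}{n-1}}.$$ Then $R(Q)$ is well defined and does not depend on $t\ge 2$, the minima in $$\mathcal O:=\min_{1\le r\le\bar r}\Big[\min_{Q\in\mathcal M(\rho,r)}R(Q)+4(1+\rho)\sqrt{\frac{4\mathcal V_0M^2r\log(9rn)}{n-1}}\Big]$$ are attained, and the following hold. (1) There is a constant $D_5>0$ depending only on $c,d,\rho$ such that, with probability at least $1-n^{-M}$, $$R(\hat A)\le\mathcal O+D_5\log(M)\sqrt{\frac{M^2\log n}{n}},$$ and on the same event, if $r_0\le\bar r(M,n)$, $$R(\hat A)\le R(A)+4(1+\rho)\sqrt{\frac{4\mathcal V_0M^2r_0\log(9r_0n)}{n-1}}+D_5\log(M)\sqrt{\frac{M^2\log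 n}{n}}.$$ (2) For every $\eta>0$ there are constants $D_3,D_4>0$ depending only on $c,d,\rho,\eta$ such that, with probability at least $1-\eta$, $$R(\hat A)\le\mathcal O+D_3\sqrt{\frac{(\log M)^2}{n\log n}}+D_4\frac{\sqrt M}{n}.$$ Here $R(\hat A)$ is the function $R$ evaluated at the random matrix $\hat A$. -/

import Mathlib

open MeasureTheory ProbabilityTheory

noncomputable section

namespace LowRankVAR

/-- The state space `ℝ^M` with the Euclidean norm. -/
abbrev Vec (M : ℕ) : Type := EuclideanSpace ℝ (Fin M)

/-- Real `M × M` matrices. -/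
abbrev Mat (M : ℕ) : Type := Matrix (Fin M) (Fin M) ℝ

/-- The product `Q x` of a matrix and a vector of the Euclidean space `ℝ^M`. -/
def act {M : ℕ} (Q : Mat M) (x : Vec M) : Vec M := Matrix.toEuclideanCLM (𝕜 := ℝ) Q x

/-- The Schatten-`∞` norm (largest singular value), i.e. the operator norm of `Q` with respect
to the Euclidean norm. -/
def schattenInf {M : ℕ} (Q : Mat M) : ℝ := ‖Matrix.toEuclideanCLM (𝕜 := ℝ) Q‖

/-- The class `𝓜(ρ, r)`: matrices of rank at most `r` and Schatten-`∞` norm at most `ρ`. -/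
def lowRank (M : ℕ) (ρ : ℝ) (r : ℕ) : Set (Mat M) :=
  {Q | Q.rank ≤ r ∧ schattenInf Q ≤ ρ}

/-- `𝒱₀ = 8 e c² d (2 - ρ) / (1 - ρ)³`. -/
def V0 (c d ρ : ℝ) : ℝ := 8 * Real.exp 1 * c ^ 2 * d * (2 - ρ) / (1 - ρ) ^ 3

/-- `δ₀ = 2 c / (1 - ρ)`. -/
def delta0 (c ρ : ℝ) : ℝ := 2 * c / (1 - ρ)

/-- The stationary vector autoregressive process `X_t = A X_{t-1} + ξ_t`, `t ≥ 2`, started at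
time `1`.  The noise variables that enter are `ξ_2, ξ_3, …`; they are i.i.d. and centered, `X_1` is
independent of them, and the process `(X_t)_{t ≥ 1}` is (strictly) stationary.
The values `X 0`, `ξ 0`, `ξ 1` play no role. -/
structure IsStationaryVAR {M : ℕ} {Ω : Type*} [MeasurableSpace Ω] (μ : Measure Ω)
    (A : Mat M) (X ξ : ℕ → Ω → Vec M) : Prop where
  measurable_X : ∀ t, 1 ≤ t → Measurable (X t)
  measurable_noise : ∀ t, 2 ≤ t → Measurable (ξ t)
  noise_indep : iIndepFun (fun t : ℕ => ξ (t + 2)) μ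
  noise_identDistrib : ∀ t, 2 ≤ t → IdentDistrib (ξ t) (ξ 2) μ μ
  noise_integrable : ∀ t, 2 ≤ t → Integrable (ξ t) μ
  noise_centered : ∀ t, 2 ≤ t → ∫ ω, ξ t ω ∂μ = 0
  init_indep : IndepFun (X 1) (fun ω (t : ℕ) => ξ (t + 2) ω) μ
  recursion : ∀ t, 1 ≤ t → ∀ᵐ ω ∂μ, X (t + 1) ω = act A (X t ω) + ξ (t + 1) ω
  stationary : ∀ h : ℕ, IdentDistrib
    (fun ω (t : ℕ) => X (t + 1 + h) ω) (fun ω (t : ℕ) => X (t + 1) ω) μ μ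

/-- Exponential moments of the noise: `𝔼 exp(|ξ_t^{(j)}| / c) ≤ d` for every coordinate `j`. -/
def HasExpMoments {M : ℕ} {Ω : Type*} [MeasurableSpace Ω] (μ : Measure Ω)
    (ξ : ℕ → Ω → Vec M) (c d : ℝ) : Prop :=
  ∀ t, 2 ≤ t → ∀ j : Fin M,
    ∫⁻ ω, ENNReal.ofReal (Real.exp (|ξ t ω j| / c)) ∂μ ≤ ENNReal.ofReal d

/-- The sample-size condition `n ≥ 1 + 16 δ₀² M r log(9 r n) / 𝒱₀` at rank `r`. -/
def SampleSizeCond (c d ρ : ℝ) (M n r : ℕ) : Prop :=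
  1 + 16 * delta0 c ρ ^ 2 * M * r * Real.log (9 * r * n) / V0 c d ρ ≤ (n : ℝ)

/-- `r̄(M, n)`: the largest integer `1 ≤ r ≤ M` with `n ≥ 1 + 16 δ₀² r log(9 r n) / 𝒱₀`. -/
def rbar (c d ρ : ℝ) (M n : ℕ) : ℕ :=
  sSup {r : ℕ | 1 ≤ r ∧ r ≤ M ∧
    1 + 16 * delta0 c ρ ^ 2 * r * Real.log (9 * r * n) / V0 c d ρ ≤ (n : ℝ)}

/-- The generalization error `R(Q) = 𝔼 ℓ(X_t - Q X_{t-1})`, written at `t = 2`. -/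
def genError {M : ℕ} {Ω : Type*} [MeasurableSpace Ω] (μ : Measure Ω)
    (ℓ : Vec M → ℝ) (X : ℕ → Ω → Vec M) (Q : Mat M) : ℝ :=
  ∫ ω, ℓ (X 2 ω - act Q (X 1 ω)) ∂μ

/-- The empirical error `R_n(Q) = (n-1)⁻¹ ∑_{i=2}^n ℓ(x_i - Q x_{i-1})` of a sample path `x`. -/
def empError {M : ℕ} (ℓ : Vec M → ℝ) (n : ℕ) (x : ℕ → Vec M) (Q : Mat M) : ℝ :=
  1 / ((n : ℝ) - 1) * ∑ i ∈ Finset.Icc 2 n, ℓ (x i - act Q (x (i - 1)))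

/-- `√(4 𝒱₀ M² r log(9 r n) / (n - 1))`. -/
def rankTerm (c d ρ : ℝ) (M n r : ℕ) : ℝ :=
  Real.sqrt (4 * V0 c d ρ * (M : ℝ) ^ 2 * r * Real.log (9 * r * n) / ((n : ℝ) - 1))

/-- `Q` is a rank-`r` empirical risk minimizer for the sample path `x`. -/
def IsFixedRankERM {M : ℕ} (ℓ : Vec M → ℝ) (ρ : ℝ) (n : ℕ) (x : ℕ → Vec M) (r : ℕ)
    (Q : Mat M) : Prop :=
  Q ∈ lowRank M ρ r ∧ ∀ Q' ∈ lowRank M ρ r, empError ℓ n x Q ≤ empError ℓ n x Q'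

/-- `Ahat` is a rank-penalized estimator: for every `ω` there are empirical risk minimizers
`B r` of each rank `r ∈ {1, …, r̄}` and a minimizer `r̂` over `r ∈ {1, …, r̄}` of the criterion
`R_n(B r) + 2 (1 + ρ) √(4 𝒱₀ M² r log(9 r n) / (n - 1))` such that `Ahat ω = B r̂`. -/
def IsRankPenalizedEstimator {M : ℕ} {Ω : Type*} (c d ρ : ℝ) (ℓ : Vec M → ℝ) (n : ℕ)
    (X : ℕ → Ω → Vec M) (Ahat : Ω → Mat M) : Prop :=
  ∀ ω, ∃ B : ℕ → Mat M, ∃ rhat : ℕ,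
    (∀ r ∈ Set.Icc 1 (rbar c d ρ M n), IsFixedRankERM ℓ ρ n (fun t => X t ω) r (B r)) ∧
    rhat ∈ Set.Icc 1 (rbar c d ρ M n) ∧
    (∀ r ∈ Set.Icc 1 (rbar c d ρ M n),
      empError ℓ n (fun t => X t ω) (B rhat) + 2 * (1 + ρ) * rankTerm c d ρ M n rhat
        ≤ empError ℓ n (fun t => X t ω) (B r) + 2 * (1 + ρ) * rankTerm c d ρ M n r) ∧
    Ahat ω = B rhat

/-- `min_{Q ∈ 𝓜(ρ, r)} R(Q)`. -/
def minRisk {M : ℕ} {Ω : Type*} [MeasurableSpace Ω] (μ : Measure Ω)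
    (ℓ : Vec M → ℝ) (X : ℕ → Ω → Vec M) (ρ : ℝ) (r : ℕ) : ℝ :=
  sInf (genError μ ℓ X '' lowRank M ρ r)

/-- The values `min_{Q ∈ 𝓜(ρ, r)} R(Q) + 4 (1 + ρ) √(4 𝒱₀ M² r log(9 r n) / (n - 1))`,
`1 ≤ r ≤ r̄(M, n)`. -/
def oracleValues {M : ℕ} {Ω : Type*} [MeasurableSpace Ω] (μ : Measure Ω)
    (ℓ : Vec M → ℝ) (X : ℕ → Ω → Vec M) (c d ρ : ℝ) (n : ℕ) : Set ℝ :=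
  (fun r : ℕ => minRisk μ ℓ X ρ r + 4 * (1 + ρ) * rankTerm c d ρ M n r) ''
    Set.Icc 1 (rbar c d ρ M n)

/-- The oracle bound: the minimum of the oracle values. -/
def oracleBound {M : ℕ} {Ω : Type*} [MeasurableSpace Ω] (μ : Measure Ω)
    (ℓ : Vec M → ℝ) (X : ℕ → Ω → Vec M) (c d ρ : ℝ) (n : ℕ) : ℝ :=
  sInf (oracleValues μ ℓ X c d ρ n)

/-- The property `P` holds with probability at least `p`: it holds on a measurable event of
probability at least `p`.  (No measurable choice of the minimizers is required.) -/
def WithProbAtLeast {Ω : Type*} [MeasurableSpace Ω] (μ : Measure Ω) (p : ℝ)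
    (P : Ω → Prop) : Prop :=
  ∃ E : Set Ω, MeasurableSet E ∧ ENNReal.ofReal p ≤ μ E ∧ ∀ ω ∈ E, P ω

/-- All standing assumptions on the model and on the loss: `A ∈ 𝓜(ρ, r₀)` with
`1 ≤ r₀ ≤ M`, the stationary autoregressive process with exponential noise moments, a loss that is
`L`-Lipschitz with `L ≤ 1`, and the sample-size condition at some rank `1 ≤ r ≤ M`. -/
structure Assumptions {M : ℕ} {Ω : Type*} [MeasurableSpace Ω] (c d ρ : ℝ) (n r₀ : ℕ)
    (μ : Measure Ω) (A : Mat M) (X ξ : ℕ → Ω → Vec M) (ℓ : Vec M → ℝ) : Prop where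
  rank_range : r₀ ∈ Set.Icc 1 M
  mem_lowRank : A ∈ lowRank M ρ r₀
  process : IsStationaryVAR μ A X ξ
  noise : HasExpMoments μ ξ c d
  loss : ∃ L : NNReal, L ≤ 1 ∧ LipschitzWith L ℓ
  sample_size : ∃ r ∈ Set.Icc 1 M, SampleSizeCond c d ρ M n r

end LowRankVAR

end

/-! The penalty dominates the fluctuations of the empirical risk over every class at once, so on one
event of probability at least 1 - n^{-M} the oracle inequality holds with no remainder. The terms
with D₃ and D₅ are then only nonnegative slack. D₄ serves when η < n^{-M}: then η n ≤ 1, and a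
deterministic bound of order √M on the excess risk suffices.

Concentration rests on the remainder e^x - 1 - x. Power means applied to its series turn the
coordinatewise moments into E expRem(s‖ξ‖) ≤ d at the scale s = 1/(√M c). A function with Lipschitz
constant a ≤ s then has log-Laplace transform at most its mean plus (a/s)² d
(`lintegral_exp_le_of_lipschitz`). Along the chain the noises are integrated out backwards; each
step replaces a function of the last state by its conditional mean, and the contraction A keeps the
Lipschitz constants bounded (`PairLipschitz.lintegral_exp_add_le`). The start of the chain needs the
same transform bound for the stationary law, where moments come from a drift inequality and the
averaging is iterated until the Lipschitz constant is small.

Write q = M r log(9rn)/(n-1), so that the rank term is 2√(M V₀ q). For a fixed matrix the Chernoff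
bound makes a deviation (1+ρ) times the rank term have probability at most (9rn)^{-7Mr} when q ≤ 1.
Factoring rank r matrices through ℝ^r gives a net of at most (2n+1)^{2Mr} points, which costs 2Mr of
this exponent; a bound on the empirical mean of ‖X_t‖ controls the passage from the net to the
class. Since r̄ is defined without the factor M, q may exceed 1; the rank term is then so large that
the plain Lipschitz bound in Q is enough. `Assumptions.exists_event` combines both regimes, and the
penalty cancels the rank term of the selected rank. -/

noncomputable section

namespace LowRankVAR

/-! ### The exponential remainder and power means -/

/-- The second order remainder `e^x - 1 - x` of the exponential. -/
def expRem (x : ℝ) : ℝ := Real.exp x - 1 - x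

theorem continuous_expRem : Continuous expRem := by
  unfold expRem; fun_prop

theorem expRem_nonneg (x : ℝ) : 0 ≤ expRem x := by
  have := Real.add_one_le_exp x
  unfold expRem; linarith

theorem hasSum_expRem (x : ℝ) :
    HasSum (fun m : ℕ => x ^ (m + 2) / (m + 2).factorial) (expRem x) := by
  have h := NormedSpace.expSeries_div_hasSum_exp (𝔸 := ℝ) x
  rw [← Real.exp_eq_exp_ℝ] at h
  have h2 := (hasSum_nat_add_iff' 2).mpr h
  have e : expRem x = Real.exp x - ∑ i ∈ Finset.range 2, x ^ i / i.factorial := by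
    simp [expRem, Finset.sum_range_succ]
    ring
  rw [e]
  exact h2

theorem expRem_le_expRem_abs (x : ℝ) : expRem x ≤ expRem |x| := by
  refine hasSum_le (fun m => ?_) (hasSum_expRem x) (hasSum_expRem |x|)
  have : x ^ (m + 2) ≤ |x| ^ (m + 2) := by
    rw [← abs_pow]; exact le_abs_self _
  gcongr

theorem expRem_mono {x y : ℝ} (hx : 0 ≤ x) (hxy : x ≤ y) : expRem x ≤ expRem y := by
  refine hasSum_le (fun m => ?_) (hasSum_expRem x) (hasSum_expRem y)
  gcongr

/-- The series starts in degree two, so a factor θ ≤ 1 comes out squared. This is the source of all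
the quadratic (sub-Gaussian) bounds below. -/
theorem expRem_mul_le {θ x : ℝ} (hθ : 0 ≤ θ) (hθ1 : θ ≤ 1) (hx : 0 ≤ x) :
    expRem (θ * x) ≤ θ ^ 2 * expRem x := by
  refine hasSum_le (fun m => ?_) (hasSum_expRem (θ * x)) ((hasSum_expRem x).mul_left (θ ^ 2))
  have h1 : θ ^ (m + 2) ≤ θ ^ 2 := pow_le_pow_of_le_one hθ hθ1 (by omega)
  rw [mul_pow, mul_div_assoc]
  gcongr

theorem sq_le_two_mul_expRem {x : ℝ} (hx : 0 ≤ x) : x ^ 2 ≤ 2 * expRem x := by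
  have := Real.quadratic_le_exp_of_nonneg hx
  unfold expRem; linarith

theorem convexOn_expRem : ConvexOn ℝ Set.univ expRem := by
  have h1 := convexOn_exp
  have h2 : ConvexOn ℝ Set.univ (fun x : ℝ => -1 - x) := by
    refine ⟨convex_univ, fun x _ y _ a b _ _ hab => ?_⟩
    simp only [smul_eq_mul]
    have : a = 1 - b := by linarith
    subst this; apply le_of_eq; ring
  refine (h1.add h2).congr fun x _ => ?_
  simp [expRem]; ring

/-- Each series term is a power mean inequality for the squares, with exponent (m + 2)/2; this
exponent is at least 1 exactly because the terms of degree 0 and 1 were removed. -/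
theorem expRem_sqrt_mean_sq_le {ι : Type*} [Fintype ι] [Nonempty ι] (y : ι → ℝ)
    (hy : ∀ i, 0 ≤ y i) :
    expRem (Real.sqrt (∑ i, (Fintype.card ι : ℝ)⁻¹ * y i ^ 2)) ≤
      ∑ i, (Fintype.card ι : ℝ)⁻¹ * expRem (y i) := by
  set Y := ∑ i, (Fintype.card ι : ℝ)⁻¹ * y i ^ 2 with hY
  have hY0 : 0 ≤ Y := Finset.sum_nonneg fun i _ => by positivity
  refine hasSum_le (fun m => ?_) (hasSum_expRem _)
    (hasSum_sum fun i _ => (hasSum_expRem (y i)).mul_left _)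
  have key := Real.rpow_arith_mean_le_arith_mean_rpow Finset.univ
    (fun _ : ι => (Fintype.card ι : ℝ)⁻¹) (fun i => y i ^ 2) (fun _ _ => by positivity)
    (by simp) (fun i _ => by positivity) (p := ((m + 2 : ℕ) : ℝ) / 2)
    (by push_cast; linarith [(Nat.cast_nonneg m : (0 : ℝ) ≤ m)])
  have conv : ∀ u : ℝ, 0 ≤ u → u ^ (((m + 2 : ℕ) : ℝ) / 2) = Real.sqrt u ^ (m + 2) := by
    intro u hu
    rw [Real.sqrt_eq_rpow, ← Real.rpow_natCast, ← Real.rpow_mul hu]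
    congr 1; ring
  rw [← hY, conv _ hY0] at key
  calc Real.sqrt Y ^ (m + 2) / (m + 2).factorial
      ≤ (∑ i, (Fintype.card ι : ℝ)⁻¹ * (y i ^ 2) ^ (((m + 2 : ℕ) : ℝ) / 2)) /
        (m + 2).factorial := by gcongr
    _ = ∑ i, (Fintype.card ι : ℝ)⁻¹ * (y i ^ (m + 2) / (m + 2).factorial) := by
      rw [Finset.sum_div]
      refine Finset.sum_congr rfl fun i _ => ?_
      rw [conv _ (by positivity), Real.sqrt_sq (hy i)]
      ring

/-! ### Laplace transforms of Lipschitz functions -/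

section ExpMoments

theorem continuous_of_abs_sub_le {E : Type*} [NormedAddCommGroup E] {f : E → ℝ} {a : ℝ} (ha : 0 ≤ a)
    (hf : ∀ x y, |f x - f y| ≤ a * ‖x - y‖) : Continuous f :=
  (LipschitzWith.of_dist_le_mul (K := ⟨a, ha⟩) fun x y => by
    rw [Real.dist_eq, dist_eq_norm]; exact hf x y).continuous

variable {E : Type*} [NormedAddCommGroup E] [MeasurableSpace E] [BorelSpace E]

theorem integrable_norm_of_expRem [SecondCountableTopology E] {ν : Measure E}
    [IsProbabilityMeasure ν] {s : ℝ} (hs : 0 < s)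
    (hint : Integrable (fun z => expRem (s * ‖z‖)) ν) : Integrable (fun z => ‖z‖) ν := by
  refine Integrable.mono' (((hint.const_mul 2).add (integrable_const 1)).div_const s)
    (by fun_prop) (ae_of_all _ fun z => ?_)
  have h := sq_le_two_mul_expRem (x := s * ‖z‖) (by positivity)
  simp only [norm_norm, Pi.add_apply]
  rw [le_div_iff₀ hs]
  nlinarith [sq_nonneg (s * ‖z‖ - 1)]

theorem integrable_of_abs_sub_le [SecondCountableTopology E] {ν : Measure E}
    [IsProbabilityMeasure ν] (hν : Integrable (fun z => ‖z‖) ν) {f : E → ℝ} {a : ℝ} (ha : 0 ≤ a)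
    (hf : ∀ x y, |f x - f y| ≤ a * ‖x - y‖) : Integrable f ν := by
  refine Integrable.mono' ((integrable_const |f 0|).add (hν.const_mul a))
    (continuous_of_abs_sub_le ha hf).aestronglyMeasurable (ae_of_all _ fun z => ?_)
  have h := hf z 0
  rw [sub_zero] at h
  have h2 := abs_sub_abs_le_abs_sub (f z) (f 0)
  simp only [Real.norm_eq_abs, Pi.add_apply]
  linarith

/-- A Lipschitz function of a vector with exponential moments has a sub-Gaussian moment
generating function, as long as the Lipschitz constant is not too large. -/
theorem lintegral_exp_le_of_lipschitz [SecondCountableTopology E] {ν : Measure E}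
    [IsProbabilityMeasure ν] {s D a : ℝ} (hs : 0 < s)
    (hint : Integrable (fun z => expRem (s * ‖z‖)) ν) (hD : ∫ z, expRem (s * ‖z‖) ∂ν ≤ D)
    (ha : 0 ≤ a) (has : a ≤ s) {f : E → ℝ} (hf : ∀ x y, |f x - f y| ≤ a * ‖x - y‖) :
    ∫⁻ z, ENNReal.ofReal (Real.exp (f z)) ∂ν ≤
      ENNReal.ofReal (Real.exp (∫ z, f z ∂ν + (a / s) ^ 2 * D)) := by
  have hfi : Integrable f ν :=
    integrable_of_abs_sub_le (integrable_norm_of_expRem hs hint) ha hf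
  -- Expanding around `f 0`: the linear part integrates to the mean of `f`, and only the remainder
  -- is estimated, through the Lipschitz bound and the factor (a/s)².
  set g : E → ℝ := fun z => Real.exp (f 0) * (1 + (f z - f 0) + (a / s) ^ 2 * expRem (s * ‖z‖))
    with hg
  have hle : ∀ z, Real.exp (f z) ≤ g z := by
    intro z
    have h1 : |f z - f 0| ≤ (a / s) * (s * ‖z‖) := by
      have := hf z 0
      rw [sub_zero] at this
      calc |f z - f 0| ≤ a * ‖z‖ := this
        _ = _ := by field_simp
    have h2 : expRem (f z - f 0) ≤ (a / s) ^ 2 * expRem (s * ‖z‖) :=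
      (expRem_le_expRem_abs _).trans ((expRem_mono (abs_nonneg _) h1).trans
        (expRem_mul_le (by positivity) ((div_le_one hs).2 has) (by positivity)))
    have h3 : Real.exp (f z) = Real.exp (f 0) * (1 + (f z - f 0) + expRem (f z - f 0)) := by
      unfold expRem
      rw [show (1 + (f z - f 0) + (Real.exp (f z - f 0) - 1 - (f z - f 0)))
        = Real.exp (f z - f 0) by ring, ← Real.exp_add]
      congr 1; ring
    rw [h3]
    simp only [hg]
    gcongr
  have hgi : Integrable g ν := by
    refine Integrable.const_mul ?_ _
    exact ((integrable_const 1).add (hfi.sub (integrable_const _))).add (hint.const_mul _)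
  have hg0 : ∀ z, 0 ≤ g z := fun z => (Real.exp_pos _).le.trans (hle z)
  calc ∫⁻ z, ENNReal.ofReal (Real.exp (f z)) ∂ν
      ≤ ∫⁻ z, ENNReal.ofReal (g z) ∂ν :=
        lintegral_mono fun z => ENNReal.ofReal_le_ofReal (hle z)
    _ = ENNReal.ofReal (∫ z, g z ∂ν) :=
        (ofReal_integral_eq_lintegral_ofReal hgi (ae_of_all _ hg0)).symm
    _ ≤ _ := by
      apply ENNReal.ofReal_le_ofReal
      have : ∫ z, g z ∂ν = Real.exp (f 0) *
          (1 + (∫ z, f z ∂ν - f 0) + (a / s) ^ 2 * ∫ z, expRem (s * ‖z‖) ∂ν) := by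
        rw [hg, integral_const_mul, integral_add, integral_add, integral_sub hfi,
          integral_const_mul]
        · simp
        · exact integrable_const _
        · exact integrable_const _
        · exact hfi.sub (integrable_const _)
        · exact (integrable_const 1).add (hfi.sub (integrable_const _))
        · exact hint.const_mul _
      rw [this, show ∫ z, f z ∂ν + (a / s) ^ 2 * D
        = f 0 + ((∫ z, f z ∂ν - f 0) + (a / s) ^ 2 * D) by ring, Real.exp_add]
      gcongr
      have h1 := Real.add_one_le_exp ((∫ z, f z ∂ν - f 0) + (a / s) ^ 2 * D)
      have h2 : (a / s) ^ 2 * ∫ z, expRem (s * ‖z‖) ∂ν ≤ (a / s) ^ 2 * D := by gcongr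
      linarith

end ExpMoments

/-! ### Moments and Laplace transforms of the stationary law -/

section StationaryLaw

open Filter Topology

variable {E : Type*} [NormedAddCommGroup E] [NormedSpace ℝ E] [MeasurableSpace E] [BorelSpace E]
  [SecondCountableTopology E]

omit [NormedSpace ℝ E] [BorelSpace E] in
/-- A drift inequality transfers moments of the noise to the stationary law. -/
theorem integrable_and_integral_le_of_stationary {P ν : Measure E} [IsProbabilityMeasure P]
    [IsProbabilityMeasure ν] {φ : E × E → E} (hφ : Measurable φ) (hstat : (P.prod ν).map φ = P)
    {ρ : ℝ} (hρ₀ : 0 ≤ ρ) (hρ₁ : ρ < 1) {F G : E → ℝ} (hF : Measurable F) (hF0 : ∀ x, 0 ≤ F x)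
    (hG : Integrable G ν) (hG0 : ∀ z, 0 ≤ G z)
    (hFG : ∀ p : E × E, F (φ p) ≤ ρ * F p.1 + (1 - ρ) * G p.2) :
    Integrable F P ∧ ∫ x, F x ∂P ≤ ∫ z, G z ∂ν := by
  set g := ∫ z, G z ∂ν with hg
  have hg0 : 0 ≤ g := integral_nonneg hG0
  have hmin : ∀ (Q : Measure E) [IsProbabilityMeasure Q] (τ : ℝ) (N : ℕ), 0 ≤ τ →
      Integrable (fun x => min (τ * F x) (N : ℝ)) Q := by
    intro Q _ τ N hτ
    refine Integrable.mono' (integrable_const (N : ℝ)) (by fun_prop) (ae_of_all _ fun x => ?_)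
    have : 0 ≤ min (τ * F x) (N : ℝ) := le_min (mul_nonneg hτ (hF0 x)) (by positivity)
    rw [Real.norm_of_nonneg this]
    exact min_le_right _ _
  -- `F` is not known to be integrable, so it is truncated at a level `N` that stays fixed while the
  -- multiplier τ is driven to 0 along ρ^k; the noise contributions add up to (1 - ρ^k) g.
  have step : ∀ (N : ℕ) (τ : ℝ), 0 ≤ τ → ∫ x, min (τ * F x) (N : ℝ) ∂P ≤
      ∫ x, min (τ * ρ * F x) (N : ℝ) ∂P + τ * (1 - ρ) * g := by
    intro N τ hτ
    have e1 : ∫ x, min (τ * F x) (N : ℝ) ∂P =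
        ∫ p, min (τ * F (φ p)) (N : ℝ) ∂(P.prod ν) := by
      conv_lhs => rw [← hstat]
      rw [integral_map hφ.aemeasurable]
      exact (by fun_prop : Measurable fun x => min (τ * F x) (N : ℝ)).aestronglyMeasurable
    have i0 : Integrable (fun p => min (τ * F (φ p)) (N : ℝ)) (P.prod ν) := by
      have := hmin P τ N hτ
      rw [← hstat] at this
      exact this.comp_measurable hφ
    have i1 : Integrable (fun p : E × E => min (τ * ρ * F p.1) (N : ℝ)) (P.prod ν) :=
      (hmin P (τ * ρ) N (by positivity)).comp_fst ν
    have i2 : Integrable (fun p : E × E => τ * (1 - ρ) * G p.2) (P.prod ν) :=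
      (hG.const_mul _).comp_snd P
    rw [e1]
    calc ∫ p, min (τ * F (φ p)) (N : ℝ) ∂(P.prod ν)
        ≤ ∫ p, (min (τ * ρ * F p.1) (N : ℝ) + τ * (1 - ρ) * G p.2) ∂(P.prod ν) := by
          refine integral_mono i0 (i1.add i2) fun p => ?_
          have h1 := mul_le_mul_of_nonneg_left (hFG p) hτ
          have h2 : 0 ≤ τ * (1 - ρ) * G p.2 :=
            mul_nonneg (mul_nonneg hτ (by linarith)) (hG0 _)
          simp only
          rcases le_total (τ * ρ * F p.1) (N : ℝ) with h | h
          · rw [min_eq_left h]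
            exact (min_le_left _ _).trans (by linarith)
          · rw [min_eq_right h]
            exact (min_le_right _ _).trans (by linarith)
      _ = _ := by
          rw [integral_add i1 i2, integral_const_mul]
          congr 1
          · exact integral_fun_fst (μ := P) (ν := ν) (f := fun x => min (τ * ρ * F x) (N : ℝ)) |>.trans
              (by simp)
          · congr 1
            exact integral_fun_snd (μ := P) (ν := ν) (f := G) |>.trans (by simp [hg])
  have iter : ∀ (N k : ℕ), ∫ x, min (1 * F x) (N : ℝ) ∂P ≤
      ∫ x, min (ρ ^ k * F x) (N : ℝ) ∂P + (1 - ρ ^ k) * g := by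
    intro N k
    induction k with
    | zero => simp
    | succ k ih =>
      have := step N (ρ ^ k) (by positivity)
      rw [← pow_succ] at this
      refine ih.trans (le_of_le_of_eq (add_le_add_left this _) ?_)
      ring
  have bound : ∀ N : ℕ, ∫ x, min (1 * F x) (N : ℝ) ∂P ≤ g := by
    intro N
    have hpow := tendsto_pow_atTop_nhds_zero_of_lt_one hρ₀ hρ₁
    have lim : Tendsto (fun k : ℕ => ∫ x, min (ρ ^ k * F x) (N : ℝ) ∂P) atTop
        (𝓝 (∫ _, (0 : ℝ) ∂P)) := by
      refine tendsto_integral_of_dominated_convergence (fun _ => (N : ℝ))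
        (fun k => (hmin P (ρ ^ k) N (by positivity)).aestronglyMeasurable) (integrable_const _)
        (fun k => ae_of_all _ fun x => ?_) (ae_of_all _ fun x => ?_)
      · rw [Real.norm_of_nonneg (le_min (mul_nonneg (by positivity) (hF0 x)) (by positivity))]
        exact min_le_right _ _
      · have := (hpow.mul_const (F x)).min (tendsto_const_nhds (x := (N : ℝ)))
        simpa using this
    have lim2 := lim.add ((hpow.const_sub 1).mul_const g)
    simp only [integral_zero, sub_zero, one_mul, zero_add] at lim2
    exact ge_of_tendsto' lim2 (iter N)
  -- Fatou's lemma removes the truncation.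
  have key : ∫⁻ x, ENNReal.ofReal (F x) ∂P ≤ ENNReal.ofReal g := by
    have hlim : ∀ x, liminf (fun N : ℕ => ENNReal.ofReal (min (1 * F x) (N : ℝ))) atTop
        = ENNReal.ofReal (F x) := by
      intro x
      refine Tendsto.liminf_eq (tendsto_const_nhds.congr' ?_)
      filter_upwards [eventually_ge_atTop ⌈F x⌉₊] with N hN
      rw [one_mul, min_eq_left ((Nat.le_ceil _).trans (by exact_mod_cast hN))]
    calc ∫⁻ x, ENNReal.ofReal (F x) ∂P
        = ∫⁻ x, liminf (fun N : ℕ => ENNReal.ofReal (min (1 * F x) (N : ℝ))) atTop ∂P := by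
          simp only [hlim]
      _ ≤ liminf (fun N : ℕ => ∫⁻ x, ENNReal.ofReal (min (1 * F x) (N : ℝ)) ∂P) atTop :=
          lintegral_liminf_le fun N => by fun_prop
      _ ≤ liminf (fun _ : ℕ => ENNReal.ofReal g) atTop := by
          refine liminf_le_liminf (Eventually.of_forall fun N => ?_)
          rw [← ofReal_integral_eq_lintegral_ofReal (hmin P 1 N zero_le_one)]
          · exact ENNReal.ofReal_le_ofReal (bound N)
          · exact ae_of_all _ fun x => le_min (by simpa using hF0 x) (by positivity)
      _ = ENNReal.ofReal g := liminf_const _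
  have hi : Integrable F P :=
    ⟨hF.aestronglyMeasurable, (hasFiniteIntegral_iff_ofReal (ae_of_all _ hF0)).2
      (key.trans_lt ENNReal.ofReal_lt_top)⟩
  refine ⟨hi, ?_⟩
  rwa [← ofReal_integral_eq_lintegral_ofReal hi (ae_of_all _ hF0),
    ENNReal.ofReal_le_ofReal_iff hg0] at key

/-- Data of a stationary law `P` of the recursion `x ↦ A x + z`, where the noise `z` has
law `ν` with an exponential moment at scale `s`. -/
structure StationaryLaw (P ν : Measure E) (A : E →L[ℝ] E) (ρ s D : ℝ) : Prop where
  pos : 0 < ρ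
  lt_one : ρ < 1
  norm_le : ‖A‖ ≤ ρ
  scale_pos : 0 < s
  integrable_noise : Integrable (fun z => expRem (s * ‖z‖)) ν
  integral_noise_le : ∫ z, expRem (s * ‖z‖) ∂ν ≤ D
  stationary : (P.prod ν).map (fun p => A p.1 + p.2) = P

namespace StationaryLaw

variable {P ν : Measure E} [IsProbabilityMeasure P] [IsProbabilityMeasure ν] {A : E →L[ℝ] E}
  {ρ s D : ℝ}

omit [IsProbabilityMeasure P] [IsProbabilityMeasure ν] in
theorem measurable_step (_h : StationaryLaw P ν A ρ s D) :
    Measurable (fun p : E × E => A p.1 + p.2) := by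
  fun_prop

omit [IsProbabilityMeasure P] [IsProbabilityMeasure ν] in
omit [BorelSpace E] [SecondCountableTopology E] in
theorem norm_apply_le (h : StationaryLaw P ν A ρ s D) (x : E) : ‖A x‖ ≤ ρ * ‖x‖ :=
  (A.le_opNorm x).trans (mul_le_mul_of_nonneg_right h.norm_le (norm_nonneg _))

/-- Since ‖A x + z‖ ≤ ρ‖x‖ + ‖z‖, shrinking the scale by 1 - ρ makes the argument a convex
combination of those of the state and of the noise, and convexity of `expRem` gives the drift
inequality. -/
theorem expRem_state (h : StationaryLaw P ν A ρ s D) :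
    Integrable (fun x => expRem (s * (1 - ρ) * ‖x‖)) P ∧
      ∫ x, expRem (s * (1 - ρ) * ‖x‖) ∂P ≤ D := by
  have hρ : 0 < 1 - ρ := by linarith [h.lt_one]
  have hs := h.scale_pos
  have := integrable_and_integral_le_of_stationary h.measurable_step h.stationary h.pos.le h.lt_one
    (F := fun x => expRem (s * (1 - ρ) * ‖x‖)) (G := fun z => expRem (s * ‖z‖))
    (continuous_expRem.measurable.comp (by fun_prop)) (fun _ => expRem_nonneg _)
    h.integrable_noise (fun _ => expRem_nonneg _) ?_
  · exact ⟨this.1, this.2.trans h.integral_noise_le⟩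
  · intro p
    have h1 : ‖A p.1 + p.2‖ ≤ ρ * ‖p.1‖ + ‖p.2‖ :=
      (norm_add_le _ _).trans (by linarith [h.norm_apply_le p.1])
    have h2 : s * (1 - ρ) * ‖A p.1 + p.2‖ ≤
        ρ * (s * (1 - ρ) * ‖p.1‖) + (1 - ρ) * (s * ‖p.2‖) := by
      calc s * (1 - ρ) * ‖A p.1 + p.2‖ ≤ s * (1 - ρ) * (ρ * ‖p.1‖ + ‖p.2‖) := by gcongr
        _ = _ := by ring
    refine (expRem_mono (by positivity) h2).trans ?_
    exact convexOn_expRem.2 (Set.mem_univ _) (Set.mem_univ _) h.pos.le hρ.le (by ring)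

omit [IsProbabilityMeasure P] in
theorem integrable_norm_noise (h : StationaryLaw P ν A ρ s D) :
    Integrable (fun z => ‖z‖) ν :=
  integrable_norm_of_expRem h.scale_pos h.integrable_noise

theorem integrable_norm_state (h : StationaryLaw P ν A ρ s D) :
    Integrable (fun x => ‖x‖) P :=
  integrable_norm_of_expRem (mul_pos h.scale_pos (by linarith [h.lt_one])) h.expRem_state.1

/-- Only the quadratic term of `expRem` is used, together with (E Y)² ≤ E Y². -/
theorem integral_norm_state_le (h : StationaryLaw P ν A ρ s D) :
    ∫ x, ‖x‖ ∂P ≤ Real.sqrt (2 * D) / (s * (1 - ρ)) := by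
  have hs : 0 < s * (1 - ρ) := mul_pos h.scale_pos (by linarith [h.lt_one])
  rw [le_div_iff₀ hs]
  apply Real.le_sqrt_of_sq_le
  have hi := h.integrable_norm_state
  set m := (∫ x, ‖x‖ ∂P) * (s * (1 - ρ)) with hm
  -- The tangent line 2my - m² ≤ y² at the mean `m`: Jensen for the square, without a separate
  -- integrability proof.
  have hpt : ∀ x : E, 2 * m * (s * (1 - ρ) * ‖x‖) - m ^ 2 ≤ 2 * expRem (s * (1 - ρ) * ‖x‖) := by
    intro x
    have := sq_le_two_mul_expRem (x := s * (1 - ρ) * ‖x‖) (by positivity)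
    nlinarith [sq_nonneg (s * (1 - ρ) * ‖x‖ - m)]
  have hint := integral_mono (μ := P) (((hi.const_mul _).const_mul _).sub (integrable_const _))
    (h.expRem_state.1.const_mul 2) hpt
  simp only [Pi.sub_apply] at hint
  rw [integral_sub ((hi.const_mul _).const_mul _) (integrable_const _), integral_const_mul,
    integral_const_mul, integral_const_mul] at hint
  simp only [integral_const, probReal_univ, one_smul] at hint
  have h2 := h.expRem_state.2
  have e : 2 * m * (s * (1 - ρ) * ∫ x, ‖x‖ ∂P) = 2 * m * m := by rw [hm]; ring
  rw [e] at hint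
  nlinarith

omit [IsProbabilityMeasure P] in
theorem integrable_noise_comp (h : StationaryLaw P ν A ρ s D) {f : E → ℝ} {a : ℝ} (ha : 0 ≤ a)
    (hf : ∀ x y, |f x - f y| ≤ a * ‖x - y‖) (y : E) : Integrable (fun z => f (y + z)) ν :=
  integrable_of_abs_sub_le h.integrable_norm_noise ha fun u v => by
    simpa using hf (y + u) (y + v)

/-- Exponential moments of Lipschitz functions under the stationary law. -/
theorem lintegral_exp_state_le (h : StationaryLaw P ν A ρ s D) {a : ℝ} (ha : 0 ≤ a)
    (has : a ≤ s) {f : E → ℝ} (hf : ∀ x y, |f x - f y| ≤ a * ‖x - y‖) :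
    ∫⁻ x, ENNReal.ofReal (Real.exp (f x)) ∂P ≤
      ENNReal.ofReal (Real.exp (∫ x, f x ∂P + (a / s) ^ 2 * D / (1 - ρ) ^ 2)) := by
  have hρ : 0 < 1 - ρ := by linarith [h.lt_one]
  have hs := h.scale_pos
  have hD : 0 ≤ D := (integral_nonneg fun _ => expRem_nonneg _).trans h.integral_noise_le
  -- The direct bound at the scale of the state only reaches a ≤ s(1-ρ). Averaging `f` over one
  -- noise step multiplies its Lipschitz constant by ρ, so induction on the number `k` of averagings
  -- reaches every a ≤ s.
  have claim : ∀ (k : ℕ) (a : ℝ), 0 ≤ a → a ≤ s → ρ ^ k * a ≤ s * (1 - ρ) → ∀ f : E → ℝ,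
      (∀ x y, |f x - f y| ≤ a * ‖x - y‖) → ∫⁻ x, ENNReal.ofReal (Real.exp (f x)) ∂P ≤
      ENNReal.ofReal (Real.exp (∫ x, f x ∂P + (a / s) ^ 2 * D / (1 - ρ) ^ 2)) := by
    intro k
    induction k with
    | zero =>
      intro a ha has hk f hf
      have := lintegral_exp_le_of_lipschitz (mul_pos hs hρ) h.expRem_state.1 h.expRem_state.2 ha
        (by simpa using hk) hf
      convert this using 4
      field_simp
    | succ k ih =>
      intro a ha has hk f hf
      have hfc := continuous_of_abs_sub_le ha hf
      set g : E → ℝ := fun x => ∫ z, f (A x + z) ∂ν with hg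
      have hfi : ∀ y, Integrable (fun z => f (y + z)) ν := h.integrable_noise_comp ha hf
      have hgl : ∀ x y, |g x - g y| ≤ (ρ * a) * ‖x - y‖ := by
        intro x y
        rw [hg]
        simp only
        rw [← integral_sub (hfi _) (hfi _)]
        calc |∫ z, (f (A x + z) - f (A y + z)) ∂ν|
            ≤ ∫ z, |f (A x + z) - f (A y + z)| ∂ν := abs_integral_le_integral_abs
          _ ≤ ∫ _, ρ * a * ‖x - y‖ ∂ν := by
            refine integral_mono ((hfi _).sub (hfi _)).abs (integrable_const _) fun z => ?_
            refine (hf _ _).trans ?_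
            rw [add_sub_add_right_eq_sub, ← map_sub]
            calc a * ‖A (x - y)‖ ≤ a * (ρ * ‖x - y‖) := by
                  gcongr; exact h.norm_apply_le _
              _ = _ := by ring
          _ = _ := by simp
      have hint : ∫ x, f x ∂P = ∫ x, g x ∂P := by
        have hfP : Integrable f P := integrable_of_abs_sub_le h.integrable_norm_state ha hf
        have hfP' := hfP
        rw [← h.stationary] at hfP'
        conv_lhs => rw [← h.stationary]
        rw [integral_map h.measurable_step.aemeasurable
          hfc.measurable.aestronglyMeasurable]
        exact integral_prod _ (hfP'.comp_measurable h.measurable_step)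
      have h1 : ∫⁻ x, ENNReal.ofReal (Real.exp (f x)) ∂P ≤
          ∫⁻ x, ENNReal.ofReal (Real.exp (g x + (a / s) ^ 2 * D)) ∂P := by
        conv_lhs => rw [← h.stationary]
        rw [lintegral_map (by fun_prop) h.measurable_step, lintegral_prod _ (by fun_prop)]
        refine lintegral_mono fun x => ?_
        exact lintegral_exp_le_of_lipschitz hs h.integrable_noise h.integral_noise_le ha has
          (f := fun z => f (A x + z)) fun u v => by simpa using hf (A x + u) (A x + v)
      have hlip2 : ∀ x y, |(g x + (a / s) ^ 2 * D) - (g y + (a / s) ^ 2 * D)| ≤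
          (ρ * a) * ‖x - y‖ := by
        intro x y; simpa using hgl x y
      have h2 := ih (ρ * a) (mul_nonneg h.pos.le ha)
        ((mul_le_of_le_one_left ha h.lt_one.le).trans has) (by rw [pow_succ] at hk; linarith)
        (fun x => g x + (a / s) ^ 2 * D) hlip2
      refine h1.trans (h2.trans (ENNReal.ofReal_le_ofReal (Real.exp_le_exp.2 ?_)))
      have hgi : Integrable g P :=
        integrable_of_abs_sub_le h.integrable_norm_state (mul_nonneg h.pos.le ha) hgl
      rw [integral_add hgi (integrable_const _), hint]
      simp only [integral_const, probReal_univ, one_smul]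
      -- The constant 1/(1-ρ)² is stable under the recursion because (1-ρ)² + ρ² ≤ 1.
      have h3 : (a / s) ^ 2 * D * (1 + ρ ^ 2 / (1 - ρ) ^ 2) ≤
          (a / s) ^ 2 * D * (1 / (1 - ρ) ^ 2) := by
        gcongr
        rw [le_div_iff₀ (by positivity), add_mul, div_mul_cancel₀ _ (by positivity)]
        nlinarith [h.pos, h.lt_one]
      have h4 : (ρ * a / s) ^ 2 * D / (1 - ρ) ^ 2 = (a / s) ^ 2 * D * (ρ ^ 2 / (1 - ρ) ^ 2) := by
        ring
      rw [h4]
      have h5 : (a / s) ^ 2 * D * (1 / (1 - ρ) ^ 2) = (a / s) ^ 2 * D / (1 - ρ) ^ 2 := by ring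
      linarith
  have hpow := (tendsto_pow_atTop_nhds_zero_of_lt_one h.pos.le h.lt_one).mul_const a
  rw [zero_mul] at hpow
  obtain ⟨k, hk⟩ := (hpow.eventually (eventually_lt_nhds (mul_pos hs hρ))).exists
  exact claim k a ha has hk.le f hf

end StationaryLaw

end StationaryLaw

/-! ### Additive functionals of the stationary chain -/

section StationaryChain

variable {E : Type*} [NormedAddCommGroup E] [NormedSpace ℝ E] [MeasurableSpace E] [BorelSpace E]
  [SecondCountableTopology E]

/-- A stationary autoregressive chain `x (k + 1) = A (x k) + ζ k` on a probability space. -/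
structure StationaryChain {Ω : Type*} [MeasurableSpace Ω] (μ : Measure Ω) (P ν : Measure E)
    (A : E →L[ℝ] E) (x ζ : ℕ → Ω → E) : Prop where
  measurable_state : ∀ k, Measurable (x k)
  measurable_noise : ∀ k, Measurable (ζ k)
  law_state : ∀ k, μ.map (x k) = P
  law_noise : ∀ k, μ.map (ζ k) = ν
  indep : ∀ k, IndepFun (fun ω => (x 0 ω, fun i : Finset.range k => ζ i ω)) (ζ k) μ
  recursion : ∀ k, ∀ᵐ ω ∂μ, x (k + 1) ω = A (x k ω) + ζ k ω

/-- The additive functional `∑_{i < k} w (x i) (x (i + 1))`. -/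
def pairSum {Ω : Type*} (w : E → E → ℝ) (x : ℕ → Ω → E) (k : ℕ) (ω : Ω) : ℝ :=
  ∑ i ∈ Finset.range k, w (x i ω) (x (i + 1) ω)

namespace StationaryChain

variable {Ω : Type*} [MeasurableSpace Ω] {μ : Measure Ω} [IsProbabilityMeasure μ]
  {P ν : Measure E} [IsProbabilityMeasure P] [IsProbabilityMeasure ν] {A : E →L[ℝ] E}
  {x ζ : ℕ → Ω → E} {ρ s D : ℝ} {w : E → E → ℝ}

omit [BorelSpace E] [SecondCountableTopology E] [IsProbabilityMeasure μ]
  [IsProbabilityMeasure P] [IsProbabilityMeasure ν] in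
theorem measurable_pairSum (hc : StationaryChain μ P ν A x ζ)
    (hw : Measurable (Function.uncurry w)) (k : ℕ) : Measurable (pairSum w x k) := by
  unfold pairSum
  refine Finset.measurable_fun_sum _ fun i _ => ?_
  exact hw.comp ((hc.measurable_state i).prodMk (hc.measurable_state (i + 1)))

omit [IsProbabilityMeasure μ] [IsProbabilityMeasure P] [IsProbabilityMeasure ν] in
-- The partial sum and the current state depend only on the initial state and the first `k` noises,
-- almost surely; this is what makes them independent of the next noise.
theorem exists_eq_past (hc : StationaryChain μ P ν A x ζ)
    (hw : Measurable (Function.uncurry w)) (k : ℕ) :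
    ∃ F : E × (Finset.range k → E) → ℝ × E, Measurable F ∧
      (fun ω => (pairSum w x k ω, x k ω)) =ᵐ[μ]
        fun ω => F (x 0 ω, fun i : Finset.range k => ζ i ω) := by
  induction k with
  | zero => exact ⟨fun z => (0, z.1), by fun_prop, ae_of_all _ fun ω => by simp [pairSum]⟩
  | succ k ih =>
    obtain ⟨F, hF, hFeq⟩ := ih
    set tr : E × (Finset.range (k + 1) → E) → E × (Finset.range k → E) := fun z =>
      (z.1, fun i => z.2 ⟨i, Finset.mem_range.2 ((Finset.mem_range.1 i.2).trans k.lt_succ_self)⟩)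
      with htr
    have htrm : Measurable tr := by fun_prop
    set nx : E × (Finset.range (k + 1) → E) → E := fun z =>
      A (F (tr z)).2 + z.2 ⟨k, Finset.self_mem_range_succ k⟩ with hnx
    have hnxm : Measurable nx := by fun_prop
    refine ⟨fun z => ((F (tr z)).1 + w (F (tr z)).2 (nx z), nx z), ?_, ?_⟩
    · refine Measurable.prodMk (Measurable.add (by fun_prop) ?_) hnxm
      exact hw.comp ((measurable_snd.comp (hF.comp htrm)).prodMk hnxm)
    · filter_upwards [hFeq, hc.recursion k] with ω h1 h2
      have h3 : F (tr (x 0 ω, fun i : Finset.range (k + 1) => ζ i ω)) =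
          (pairSum w x k ω, x k ω) := h1.symm
      have h4 : nx (x 0 ω, fun i : Finset.range (k + 1) => ζ i ω) = x (k + 1) ω := by
        simp only [hnx]
        rw [h3, h2]
      rw [h3, h4]
      simp [pairSum, Finset.sum_range_succ]

omit [IsProbabilityMeasure μ] [IsProbabilityMeasure P] [IsProbabilityMeasure ν] in
theorem indepFun_pairSum (hc : StationaryChain μ P ν A x ζ)
    (hw : Measurable (Function.uncurry w)) (k : ℕ) :
    IndepFun (fun ω => (pairSum w x k ω, x k ω)) (ζ k) μ := by
  obtain ⟨F, hF, hFeq⟩ := hc.exists_eq_past hw k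
  exact ((hc.indep k).comp hF measurable_id).congr hFeq.symm (Filter.EventuallyEq.refl _ _)

omit [IsProbabilityMeasure μ] [IsProbabilityMeasure P] [IsProbabilityMeasure ν] in
theorem indepFun_state (hc : StationaryChain μ P ν A x ζ) (k : ℕ) :
    IndepFun (x k) (ζ k) μ :=
  (hc.indepFun_pairSum (w := fun _ _ => 0) (by exact measurable_const) k).comp
    measurable_snd measurable_id

omit [IsProbabilityMeasure P] [IsProbabilityMeasure ν] in
theorem map_state_noise (hc : StationaryChain μ P ν A x ζ) (k : ℕ) :
    μ.map (fun ω => (x k ω, ζ k ω)) = P.prod ν := by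
  rw [(hc.indepFun_state k).map_prod_eq_prod_map_map (hc.measurable_state k).aemeasurable
    (hc.measurable_noise k).aemeasurable, hc.law_state, hc.law_noise]

omit [IsProbabilityMeasure P] [IsProbabilityMeasure ν] in
/-- The stationary law satisfies its invariance equation. -/
theorem map_step (hc : StationaryChain μ P ν A x ζ) :
    (P.prod ν).map (fun p : E × E => A p.1 + p.2) = P := by
  rw [← hc.map_state_noise 0, Measure.map_map (by fun_prop)
    ((hc.measurable_state 0).prodMk (hc.measurable_noise 0)), ← hc.law_state 1]
  refine Measure.map_congr ?_
  filter_upwards [hc.recursion 0] with ω h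
  exact h.symm

end StationaryChain

/-- Lipschitz conditions on a function of two consecutive states. -/
structure PairLipschitz (A : E →L[ℝ] E) (w : E → E → ℝ) (α β : ℝ) : Prop where
  measurable : Measurable (Function.uncurry w)
  nonneg_next : 0 ≤ α
  nonneg_step : 0 ≤ β
  next : ∀ x y y', |w x y - w x y'| ≤ α * ‖y - y'‖
  step : ∀ x x' z, |w x (A x + z) - w x' (A x' + z)| ≤ β * ‖x - x'‖

namespace PairLipschitz

variable {Ω : Type*} [MeasurableSpace Ω] {μ : Measure Ω} [IsProbabilityMeasure μ]
  {P ν : Measure E} [IsProbabilityMeasure P] [IsProbabilityMeasure ν] {A : E →L[ℝ] E}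
  {x ζ : ℕ → Ω → E} {ρ s D : ℝ} {w : E → E → ℝ} {α β : ℝ}

theorem integrable_prod (hw : PairLipschitz A w α β) (h : StationaryLaw P ν A ρ s D) :
    Integrable (fun p : E × E => w p.1 (A p.1 + p.2)) (P.prod ν) := by
  have hm : Measurable (fun p : E × E => w p.1 (A p.1 + p.2)) :=
    hw.measurable.comp (measurable_fst.prodMk h.measurable_step)
  have hi : Integrable (fun p : E × E => |w 0 0| + α * ‖p.2‖ + β * ‖p.1‖) (P.prod ν) :=
    ((integrable_const _).add ((h.integrable_norm_noise.comp_snd P).const_mul α)).add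
      ((h.integrable_norm_state.comp_fst ν).const_mul β)
  refine hi.mono' hm.aestronglyMeasurable (ae_of_all _ fun p => ?_)
  have h1 := hw.step p.1 0 p.2
  have h2 := hw.next 0 p.2 0
  simp only [map_zero, zero_add, sub_zero] at h1 h2
  have h3 := abs_sub_abs_le_abs_sub (w p.1 (A p.1 + p.2)) (w 0 p.2)
  have h4 := abs_sub_abs_le_abs_sub (w 0 p.2) (w 0 0)
  rw [Real.norm_eq_abs]
  linarith

/-- The moment generating function of an additive functional of a stationary chain, with a
Lipschitz function of the last state added so that the noise can be integrated out
step by step. -/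
theorem lintegral_exp_add_le (hw : PairLipschitz A w α β) (h : StationaryLaw P ν A ρ s D)
    (hc : StationaryChain μ P ν A x ζ) {γ : ℝ} (hγ : α + β / (1 - ρ) ≤ γ / (1 - ρ))
    (hγs : γ / (1 - ρ) ≤ s) (k : ℕ) :
    ∀ (a : ℝ) (g : E → ℝ), 0 ≤ a → a ≤ β / (1 - ρ) → (∀ x y, |g x - g y| ≤ a * ‖x - y‖) →
      ∫⁻ ω, ENNReal.ofReal (Real.exp (pairSum w x k ω + g (x k ω))) ∂μ ≤
        ENNReal.ofReal (Real.exp (k * ∫ p, w p.1 (A p.1 + p.2) ∂(P.prod ν) + ∫ y, g y ∂P +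
          D / s ^ 2 * (k * γ ^ 2 / (1 - ρ) ^ 2 + (k * β + a) * γ / (1 - ρ) ^ 3))) := by
  have hρ : 0 < 1 - ρ := by linarith [h.lt_one]
  have hs := h.scale_pos
  have hD : 0 ≤ D := (integral_nonneg fun _ => expRem_nonneg _).trans h.integral_noise_le
  have hβ := hw.nonneg_step
  have hα := hw.nonneg_next
  have hβγ : β / (1 - ρ) ≤ γ / (1 - ρ) := by linarith
  have hγ0 : 0 ≤ γ := by
    have : β ≤ γ := by rwa [div_le_div_iff_of_pos_right hρ] at hβγ
    linarith
  induction k with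
  | zero =>
    intro a g ha ha' hg
    have hgc := continuous_of_abs_sub_le ha hg
    have h1 := h.lintegral_exp_state_le ha (ha'.trans (hβγ.trans hγs)) hg
    rw [← hc.law_state 0, lintegral_map (by fun_prop) (hc.measurable_state 0)] at h1
    simp only [pairSum, Finset.range_zero, Finset.sum_empty, zero_add, CharP.cast_eq_zero,
      zero_mul, zero_div]
    refine h1.trans (ENNReal.ofReal_le_ofReal (Real.exp_le_exp.2 ?_))
    rw [hc.law_state]
    refine add_le_add le_rfl ?_
    calc (a / s) ^ 2 * D / (1 - ρ) ^ 2 = D / s ^ 2 * (a * a / (1 - ρ) ^ 2) := by ring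
      _ ≤ D / s ^ 2 * (a * (γ / (1 - ρ)) / (1 - ρ) ^ 2) := by
        gcongr; exact ha'.trans hβγ
      _ = D / s ^ 2 * (a * γ / (1 - ρ) ^ 3) := by
        field_simp
  | succ k ih =>
    intro a g ha ha' hg
    have hgc := continuous_of_abs_sub_le ha hg
    have hgP : Integrable g P := integrable_of_abs_sub_le h.integrable_norm_state ha hg
    -- What the last noise enters: the last summand and the terminal function. Its Lipschitz
    -- constant in the noise is α + a, which the hypothesis on γ keeps below γ/(1-ρ) ≤ s.
    set u : E → E → ℝ := fun y z => w y (A y + z) + g (A y + z) with hu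
    have hum : Measurable (Function.uncurry u) :=
      (hw.measurable.comp (measurable_fst.prodMk h.measurable_step)).add
        (hgc.measurable.comp h.measurable_step)
    have hul : ∀ y z z', |u y z - u y z'| ≤ (α + a) * ‖z - z'‖ := by
      intro y z z'
      have h1 := hw.next y (A y + z) (A y + z')
      have h2 := hg (A y + z) (A y + z')
      rw [add_sub_add_left_eq_sub] at h1 h2
      calc |u y z - u y z'| = |(w y (A y + z) - w y (A y + z')) + (g (A y + z) - g (A y + z'))| := by
            rw [hu]; congr 1; ring
        _ ≤ _ := abs_add_le _ _
        _ ≤ _ := by linarith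
    have hul2 : ∀ y y' z, |u y z - u y' z| ≤ (β + ρ * a) * ‖y - y'‖ := by
      intro y y' z
      have h1 := hw.step y y' z
      have h2 := hg (A y + z) (A y' + z)
      rw [add_sub_add_right_eq_sub, ← map_sub] at h2
      have h3 := mul_le_mul_of_nonneg_left (h.norm_apply_le (y - y')) ha
      calc |u y z - u y' z| =
            |(w y (A y + z) - w y' (A y' + z)) + (g (A y + z) - g (A y' + z))| := by
            rw [hu]; congr 1; ring
        _ ≤ _ := abs_add_le _ _
        _ ≤ _ := by linarith
    have hαa : 0 ≤ α + a := by linarith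
    have hui : ∀ y, Integrable (u y) ν := fun y =>
      integrable_of_abs_sub_le h.integrable_norm_noise hαa (hul y)
    set v : ℝ := ((α + a) / s) ^ 2 * D with hv
    -- The new terminal function: the conditional mean given the state, plus the Laplace cost `v` of
    -- the noise.
    set G : E → ℝ := fun y => ∫ z, u y z ∂ν + v with hG
    have hGl : ∀ y y', |G y - G y'| ≤ (β + ρ * a) * ‖y - y'‖ := by
      intro y y'
      simp only [hG, add_sub_add_right_eq_sub]
      rw [← integral_sub (hui _) (hui _)]
      calc |∫ z, (u y z - u y' z) ∂ν| ≤ ∫ z, |u y z - u y' z| ∂ν := abs_integral_le_integral_abs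
        _ ≤ ∫ _, (β + ρ * a) * ‖y - y'‖ ∂ν :=
          integral_mono ((hui _).sub (hui _)).abs (integrable_const _) fun z => hul2 y y' z
        _ = _ := by simp
    have hρa : 0 ≤ β + ρ * a := add_nonneg hβ (mul_nonneg h.pos.le ha)
    have hGc := continuous_of_abs_sub_le hρa hGl
    -- β/(1-ρ) is the fixed point of a ↦ β + ρ a, hence the range of `a` is preserved by the
    -- induction.
    have hρa' : β + ρ * a ≤ β / (1 - ρ) := by
      rw [le_div_iff₀ hρ] at ha' ⊢
      nlinarith [h.pos]
    have hGint : ∫ y, G y ∂P =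
        ∫ p, w p.1 (A p.1 + p.2) ∂(P.prod ν) + ∫ y, g y ∂P + v := by
      have hgs : Integrable (fun p : E × E => g (A p.1 + p.2)) (P.prod ν) := by
        have := hgP
        rw [← h.stationary] at this
        exact this.comp_measurable h.measurable_step
      have hup : Integrable (fun p : E × E => u p.1 p.2) (P.prod ν) :=
        (hw.integrable_prod h).add hgs
      have e1 : ∫ y, g y ∂P = ∫ p, g (A p.1 + p.2) ∂(P.prod ν) := by
        conv_lhs => rw [← h.stationary]
        exact integral_map h.measurable_step.aemeasurable hgc.aestronglyMeasurable
      have e2 : ∫ y, ∫ z, u y z ∂ν ∂P = ∫ p, u p.1 p.2 ∂(P.prod ν) :=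
        (integral_prod _ hup).symm
      rw [hG, integral_add hup.integral_prod_left (integrable_const _), e2, e1, hu]
      simp only
      rw [integral_add (hw.integrable_prod h) hgs]
      simp
    have hfun : Measurable fun p : (ℝ × E) × E =>
        ENNReal.ofReal (Real.exp (p.1.1 + u p.1.2 p.2)) := by
      have : Measurable fun p : (ℝ × E) × E => u p.1.2 p.2 :=
        hum.comp ((measurable_snd.comp measurable_fst).prodMk measurable_snd)
      fun_prop
    have hpm : Measurable (fun ω => (pairSum w x k ω, x k ω)) :=
      (hc.measurable_pairSum hw.measurable k).prodMk (hc.measurable_state k)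
    have : IsProbabilityMeasure (μ.map (fun ω => (pairSum w x k ω, x k ω))) :=
      Measure.isProbabilityMeasure_map hpm.aemeasurable
    have h1 : ∫⁻ ω, ENNReal.ofReal (Real.exp (pairSum w x (k + 1) ω + g (x (k + 1) ω))) ∂μ ≤
        ∫⁻ ω, ENNReal.ofReal (Real.exp (pairSum w x k ω + G (x k ω))) ∂μ := by
      calc ∫⁻ ω, ENNReal.ofReal (Real.exp (pairSum w x (k + 1) ω + g (x (k + 1) ω))) ∂μ
          = ∫⁻ ω, ENNReal.ofReal (Real.exp (pairSum w x k ω + u (x k ω) (ζ k ω))) ∂μ := by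
            refine lintegral_congr_ae ?_
            filter_upwards [hc.recursion k] with ω hω
            simp only [pairSum, Finset.sum_range_succ, hω, hu]
            rw [add_assoc]
        _ = ∫⁻ p, ENNReal.ofReal (Real.exp (p.1.1 + u p.1.2 p.2))
              ∂((μ.map (fun ω => (pairSum w x k ω, x k ω))).prod ν) := by
            rw [← hc.law_noise k, ← (hc.indepFun_pairSum hw.measurable k).map_prod_eq_prod_map_map
              hpm.aemeasurable (hc.measurable_noise k).aemeasurable,
              lintegral_map hfun (hpm.prodMk (hc.measurable_noise k))]
        _ = ∫⁻ q, ∫⁻ z, ENNReal.ofReal (Real.exp (q.1 + u q.2 z)) ∂ν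
              ∂(μ.map (fun ω => (pairSum w x k ω, x k ω))) :=
            lintegral_prod _ hfun.aemeasurable
        _ ≤ ∫⁻ q, ENNReal.ofReal (Real.exp (q.1 + G q.2))
              ∂(μ.map (fun ω => (pairSum w x k ω, x k ω))) := by
            refine lintegral_mono fun q => ?_
            have := lintegral_exp_le_of_lipschitz hs h.integrable_noise h.integral_noise_le hαa
              (by linarith) (f := fun z => q.1 + u q.2 z) fun z z' => by
                rw [add_sub_add_left_eq_sub]; exact hul q.2 z z'
            rw [integral_add (integrable_const _) (hui _)] at this
            simpa [hG, hv, add_assoc] using this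
        _ = _ := by
            rw [lintegral_map (by fun_prop) hpm]
    refine h1.trans ((ih (β + ρ * a) G hρa hρa' hGl).trans
      (ENNReal.ofReal_le_ofReal (Real.exp_le_exp.2 ?_)))
    rw [hGint]
    have hv2 : v ≤ D / s ^ 2 * (γ ^ 2 / (1 - ρ) ^ 2) := by
      calc v = D / s ^ 2 * (α + a) ^ 2 := by rw [hv]; ring
        _ ≤ D / s ^ 2 * (γ / (1 - ρ)) ^ 2 := by
          gcongr; linarith
        _ = _ := by rw [div_pow]
    -- The budget kβ + a for the initial state absorbs the change of terminal function since ρ ≤ 1.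
    have h3 : D / s ^ 2 * ((k * β + (β + ρ * a)) * γ / (1 - ρ) ^ 3) ≤
        D / s ^ 2 * (((k + 1) * β + a) * γ / (1 - ρ) ^ 3) := by
      gcongr D / s ^ 2 * (?_ * γ / (1 - ρ) ^ 3)
      nlinarith [h.lt_one]
    have e1 : ∀ t : ℝ, D / s ^ 2 * (k * γ ^ 2 / (1 - ρ) ^ 2 + t) =
        k * (D / s ^ 2 * (γ ^ 2 / (1 - ρ) ^ 2)) + D / s ^ 2 * t := by intro t; ring
    have e2 : ∀ t : ℝ, D / s ^ 2 * ((k + 1) * γ ^ 2 / (1 - ρ) ^ 2 + t) =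
        (k + 1) * (D / s ^ 2 * (γ ^ 2 / (1 - ρ) ^ 2)) + D / s ^ 2 * t := by intro t; ring
    push_cast
    rw [e1, e2]
    linarith

theorem lintegral_exp_pairSum_le (hw : PairLipschitz A w α β) (h : StationaryLaw P ν A ρ s D)
    (hc : StationaryChain μ P ν A x ζ) {γ : ℝ} (hγ : α + β / (1 - ρ) ≤ γ / (1 - ρ))
    (hβγ : β ≤ γ) (hγs : γ / (1 - ρ) ≤ s) (k : ℕ) :
    ∫⁻ ω, ENNReal.ofReal (Real.exp (pairSum w x k ω)) ∂μ ≤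
        ENNReal.ofReal (Real.exp (k * ∫ p, w p.1 (A p.1 + p.2) ∂(P.prod ν) +
          k * γ ^ 2 * (D / s ^ 2 * ((2 - ρ) / (1 - ρ) ^ 3)))) := by
  have hρ : 0 < 1 - ρ := by linarith [h.lt_one]
  have hs := h.scale_pos
  have hD : 0 ≤ D := (integral_nonneg fun _ => expRem_nonneg _).trans h.integral_noise_le
  have hβ := hw.nonneg_step
  have := hw.lintegral_exp_add_le h hc hγ hγs k 0 (fun _ => 0) le_rfl (by positivity) (by simp)
  simp only [add_zero, integral_zero] at this
  refine this.trans (ENNReal.ofReal_le_ofReal (Real.exp_le_exp.2 ?_))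
  refine add_le_add le_rfl ?_
  calc D / s ^ 2 * (k * γ ^ 2 / (1 - ρ) ^ 2 + k * β * γ / (1 - ρ) ^ 3)
      ≤ D / s ^ 2 * (k * γ ^ 2 / (1 - ρ) ^ 2 + k * γ * γ / (1 - ρ) ^ 3) := by
        have : 0 ≤ γ := hβ.trans hβγ
        gcongr
    _ = _ := by
      have : k * γ ^ 2 / (1 - ρ) ^ 2 = k * γ ^ 2 * (1 - ρ) / (1 - ρ) ^ 3 := by
        field_simp
      rw [this]; ring

/-- Chernoff bound for an additive functional of a stationary chain. -/
theorem measure_pairSum_ge_le (hw : PairLipschitz A w α β) (h : StationaryLaw P ν A ρ s D)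
    (hc : StationaryChain μ P ν A x ζ) {γ : ℝ} (hγ : α + β / (1 - ρ) ≤ γ / (1 - ρ))
    (hβγ : β ≤ γ) (hγs : γ / (1 - ρ) ≤ s) (k : ℕ) (t : ℝ) :
    μ {ω | k * ∫ p, w p.1 (A p.1 + p.2) ∂(P.prod ν) + t ≤ pairSum w x k ω} ≤
      ENNReal.ofReal (Real.exp
        (k * γ ^ 2 * (D / s ^ 2 * ((2 - ρ) / (1 - ρ) ^ 3)) - t)) := by
  set m := k * ∫ p, w p.1 (A p.1 + p.2) ∂(P.prod ν)
  have h1 := hw.lintegral_exp_pairSum_le h hc hγ hβγ hγs k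
  have hm := hc.measurable_pairSum hw.measurable k
  have h2 := mul_meas_ge_le_lintegral (μ := μ)
    (f := fun ω => ENNReal.ofReal (Real.exp (pairSum w x k ω))) (by fun_prop)
    (ENNReal.ofReal (Real.exp (m + t)))
  have h3 : {ω | ENNReal.ofReal (Real.exp (m + t)) ≤
      ENNReal.ofReal (Real.exp (pairSum w x k ω))} = {ω | m + t ≤ pairSum w x k ω} := by
    ext ω
    simp only [Set.mem_ofPred_eq]
    rw [ENNReal.ofReal_le_ofReal_iff (Real.exp_pos _).le, Real.exp_le_exp]
  rw [h3] at h2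
  have h4 := h2.trans h1
  have hpos : 0 < Real.exp (m + t) := Real.exp_pos _
  rw [mul_comm, ← ENNReal.le_div_iff_mul_le (Or.inl (by simpa using hpos))
    (Or.inl ENNReal.ofReal_ne_top), ← ENNReal.ofReal_div_of_pos hpos, ← Real.exp_sub] at h4
  convert h4 using 3
  ring

end PairLipschitz

end StationaryChain

/-! ### Low rank matrices: compactness, factorization, nets -/

section Matrices

open Module

variable {M : ℕ}

theorem act_sub (Q Q' : Mat M) (x : Vec M) : act (Q - Q') x = act Q x - act Q' x := by
  simp [act]

theorem norm_act_le (Q : Mat M) (x : Vec M) : ‖act Q x‖ ≤ schattenInf Q * ‖x‖ :=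
  ContinuousLinearMap.le_opNorm _ _

theorem schattenInf_sub_le (Q Q' : Mat M) :
    schattenInf (Q - Q') ≤ schattenInf Q + schattenInf Q' := by
  unfold schattenInf
  rw [map_sub]
  exact norm_sub_le _ _

theorem rank_eq_finrank_range_toEuclideanCLM (Q : Mat M) :
    Q.rank = finrank ℝ (LinearMap.range
      (Matrix.toEuclideanCLM (𝕜 := ℝ) Q : Vec M →ₗ[ℝ] Vec M)) := by
  rw [Matrix.coe_toEuclideanCLM_eq_toEuclideanLin, Matrix.toEuclideanLin_eq_toLin_orthonormal]
  exact Matrix.rank_eq_finrank_range_toLin _ _ _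

theorem zero_mem_lowRank {ρ : ℝ} (hρ : 0 ≤ ρ) (r : ℕ) : (0 : Mat M) ∈ lowRank M ρ r := by
  refine ⟨by simp, ?_⟩
  simpa [schattenInf] using hρ

/-- Having rank at least r + 1 is an open condition, and closed balls of operators are compact in
finite dimension. Working with operators supplies the norm topology; the result serves the existence
of risk minimizers. -/
theorem isCompact_image_lowRank (ρ : ℝ) (r : ℕ) :
    IsCompact ((fun Q : Mat M => Matrix.toEuclideanCLM (𝕜 := ℝ) Q) '' lowRank M ρ r) := by
  have e : (fun Q : Mat M => Matrix.toEuclideanCLM (𝕜 := ℝ) Q) '' lowRank M ρ r =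
      {T : Vec M →L[ℝ] Vec M | ((r + 1 : ℕ) : Cardinal) ≤ (T : Vec M →ₗ[ℝ] Vec M).rank}ᶜ ∩
        Metric.closedBall 0 ρ := by
    have hr : ∀ T : Vec M →L[ℝ] Vec M,
        T ∈ {T : Vec M →L[ℝ] Vec M | ((r + 1 : ℕ) : Cardinal) ≤
          (T : Vec M →ₗ[ℝ] Vec M).rank}ᶜ ↔
        finrank ℝ (LinearMap.range (T : Vec M →ₗ[ℝ] Vec M)) ≤ r := by
      intro T
      rw [Set.mem_compl_iff, Set.mem_ofPred_eq, LinearMap.rank, ← finrank_eq_rank, Nat.cast_le]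
      omega
    ext T
    rw [Set.mem_inter_iff, hr, mem_closedBall_zero_iff]
    constructor
    · rintro ⟨Q, ⟨h1, h2⟩, rfl⟩
      exact ⟨by rw [← rank_eq_finrank_range_toEuclideanCLM]; exact h1, h2⟩
    · rintro ⟨h1, h2⟩
      refine ⟨(Matrix.toEuclideanCLM (𝕜 := ℝ)).symm T, ⟨?_, ?_⟩, by simp⟩
      · rw [rank_eq_finrank_range_toEuclideanCLM, StarAlgEquiv.apply_symm_apply]; exact h1
      · simpa [schattenInf] using h2
  rw [e]
  exact (isCompact_closedBall _ _).inter_left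
    (isOpen_setOfPred_nat_le_rank (r + 1)).isClosed_compl

/-- A subspace of dimension at most `r` embeds isometrically into `ℝ^r`. -/
theorem exists_linearIsometry_of_finrank_le {V : Type*} [NormedAddCommGroup V]
    [InnerProductSpace ℝ V] [FiniteDimensional ℝ V] {r : ℕ} (hr : finrank ℝ V ≤ r) :
    Nonempty (V →ₗᵢ[ℝ] EuclideanSpace ℝ (Fin r)) := by
  let b := stdOrthonormalBasis ℝ V
  let e := EuclideanSpace.basisFun (Fin r) ℝ
  let f : V →ₗ[ℝ] EuclideanSpace ℝ (Fin r) := b.toBasis.constr ℝ fun i => e (Fin.castLE hr i)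
  refine ⟨f.isometryOfOrthonormal (v := b.toBasis) (by simp) ?_⟩
  have : f ∘ b.toBasis = e ∘ Fin.castLE hr := by
    ext1 i
    exact b.toBasis.constr_basis ℝ _ i
  rw [this]
  exact e.orthonormal.comp _ (Fin.castLE_injective hr)

/-- A matrix of rank at most `r` factors through `ℝ^r` with a contraction as left factor. -/
theorem exists_factorization {ρ : ℝ} {r : ℕ} {Q : Mat M} (hQ : Q ∈ lowRank M ρ r) :
    ∃ (U : EuclideanSpace ℝ (Fin r) →L[ℝ] Vec M) (V : Vec M →L[ℝ] EuclideanSpace ℝ (Fin r)),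
      ‖U‖ ≤ 1 ∧ ‖V‖ ≤ ρ ∧ Matrix.toEuclideanCLM (𝕜 := ℝ) Q = U ∘L V := by
  set T := Matrix.toEuclideanCLM (𝕜 := ℝ) Q with hT
  obtain ⟨ι⟩ := exists_linearIsometry_of_finrank_le
    ((rank_eq_finrank_range_toEuclideanCLM Q).symm.le.trans hQ.1)
  set W := LinearMap.range (T : Vec M →ₗ[ℝ] Vec M)
  set κ : W →L[ℝ] EuclideanSpace ℝ (Fin r) := ι.toContinuousLinearMap with hκ
  have hκn : ‖κ‖ ≤ 1 := ι.norm_toContinuousLinearMap_le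
  set T' : Vec M →L[ℝ] W := T.codRestrict W fun x => LinearMap.mem_range_self _ x with hT'
  -- The range of Q is embedded isometrically in ℝ^r by κ, and κ* κ = 1 returns to the range.
  refine ⟨W.subtypeL ∘L ContinuousLinearMap.adjoint κ, κ ∘L T', ?_, ?_, ?_⟩
  · refine (ContinuousLinearMap.opNorm_comp_le _ _).trans ?_
    have h1 : ‖W.subtypeL‖ ≤ 1 := W.norm_subtypeL_le
    have h2 : ‖ContinuousLinearMap.adjoint κ‖ ≤ 1 := by
      rw [LinearIsometryEquiv.norm_map]; exact hκn
    exact (mul_le_mul h1 h2 (by positivity) zero_le_one).trans (one_mul 1).le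
  · refine ContinuousLinearMap.opNorm_le_bound _ ((norm_nonneg _).trans hQ.2) fun x => ?_
    have : ‖(κ ∘L T') x‖ = ‖T x‖ := ι.norm_map (T' x)
    rw [this]
    exact (T.le_opNorm x).trans (mul_le_mul_of_nonneg_right hQ.2 (norm_nonneg _))
  · ext1 x
    have h1 : ContinuousLinearMap.adjoint κ (κ (T' x)) = T' x := by
      refine ext_inner_right ℝ fun y => ?_
      rw [ContinuousLinearMap.adjoint_inner_left]
      exact ι.inner_map_map _ _
    simp only [ContinuousLinearMap.comp_apply, h1]
    rfl

/-- The operator norm is bounded by the Frobenius norm, by Cauchy–Schwarz in each row. -/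
theorem norm_le_of_entries_le {p q : ℕ}
    (T : EuclideanSpace ℝ (Fin p) →L[ℝ] EuclideanSpace ℝ (Fin q)) {h : ℝ} (hh : 0 ≤ h)
    (hT : ∀ i j, |T (EuclideanSpace.single j 1) i| ≤ h) : ‖T‖ ≤ Real.sqrt (p * q) * h := by
  refine ContinuousLinearMap.opNorm_le_bound _ (by positivity) fun x => ?_
  have hx : T x = ∑ j, x j • T (EuclideanSpace.single j 1) := by
    conv_lhs => rw [← (EuclideanSpace.basisFun (Fin p) ℝ).sum_repr x]
    simp [map_sum]
  have hent : ∀ i, (T x i) ^ 2 ≤ p * h ^ 2 * ‖x‖ ^ 2 := by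
    intro i
    have e1 : T x i = ∑ j, x j * T (EuclideanSpace.single j 1) i := by
      rw [hx]; simp
    rw [e1, EuclideanSpace.real_norm_sq_eq]
    calc (∑ j, x j * T (EuclideanSpace.single j 1) i) ^ 2
        ≤ (∑ j, x j ^ 2) * ∑ j, (T (EuclideanSpace.single j 1) i) ^ 2 :=
          Finset.sum_mul_sq_le_sq_mul_sq _ _ _
      _ ≤ (∑ j, x j ^ 2) * ∑ _j : Fin p, h ^ 2 := by
          refine mul_le_mul_of_nonneg_left (Finset.sum_le_sum fun j _ => ?_)
            (Finset.sum_nonneg fun j _ => sq_nonneg _)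
          rw [← sq_abs]
          exact pow_le_pow_left₀ (abs_nonneg _) (hT i j) 2
      _ = _ := by simp; ring
  apply le_of_sq_le_sq _ (by positivity)
  rw [EuclideanSpace.real_norm_sq_eq]
  calc ∑ i, T x i ^ 2 ≤ ∑ _i : Fin q, p * h ^ 2 * ‖x‖ ^ 2 := Finset.sum_le_sum fun i _ => hent i
    _ = _ := by
      rw [mul_pow, mul_pow, Real.sq_sqrt (by positivity)]
      simp; ring

theorem abs_entry_le {p q : ℕ}
    (T : EuclideanSpace ℝ (Fin p) →L[ℝ] EuclideanSpace ℝ (Fin q)) (hT : ‖T‖ ≤ 1) (i j) :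
    |T (EuclideanSpace.single j 1) i| ≤ 1 := by
  have h1 := PiLp.norm_apply_le (T (EuclideanSpace.single j (1 : ℝ))) i
  have h2 := T.le_opNorm (EuclideanSpace.single j (1 : ℝ))
  rw [PiLp.norm_single, norm_one, mul_one] at h2
  rw [Real.norm_eq_abs] at h1
  linarith

theorem floor_mul_mem_Icc {n : ℕ} {u : ℝ} (hu : |u| ≤ 1) :
    ⌊(n : ℝ) * u⌋ ∈ Finset.Icc (-(n : ℤ)) n := by
  have hn : (0 : ℝ) ≤ n := Nat.cast_nonneg n
  rw [abs_le] at hu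
  rw [Finset.mem_Icc]
  constructor
  · apply Int.le_floor.2
    push_cast
    nlinarith
  · have : ((⌊(n : ℝ) * u⌋ : ℤ) : ℝ) ≤ ((n : ℤ) : ℝ) := by
      refine (Int.floor_le _).trans ?_
      push_cast
      nlinarith
    exact_mod_cast this

theorem abs_sub_le_of_floor_eq {n : ℕ} (hn : 1 ≤ n) {u v : ℝ}
    (h : ⌊(n : ℝ) * u⌋ = ⌊(n : ℝ) * v⌋) : |u - v| ≤ 1 / n := by
  have hn' : (0 : ℝ) < n := by exact_mod_cast hn
  have := (Int.abs_sub_lt_one_of_floor_eq_floor h).le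
  rw [← mul_sub, abs_mul, abs_of_pos hn'] at this
  rw [le_div_iff₀ hn']
  linarith

/-- A finite net of the class of low rank matrices. -/
theorem exists_net {ρ : ℝ} (hρ₀ : 0 ≤ ρ) (hρ₁ : ρ ≤ 1) (r : ℕ) {n : ℕ} (hn : 1 ≤ n) :
    ∃ T : Finset (Mat M), (∀ Q ∈ T, Q ∈ lowRank M ρ r) ∧ T.card ≤ (2 * n + 1) ^ (2 * M * r) ∧
      ∀ Q ∈ lowRank M ρ r, ∃ Q' ∈ T, schattenInf (Q - Q') ≤ 2 * Real.sqrt (M * r) / n := by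
  classical
  choose! U V hU hV hUV using fun (Q : Mat M) (hQ : Q ∈ lowRank M ρ r) => exists_factorization hQ
  let K : Type := (Fin M × Fin r) ⊕ (Fin r × Fin M) → Finset.Icc (-(n : ℤ)) n
  -- Each of the 2Mr entries of the two factors lies in [-1, 1] and is rounded to the grid of mesh
  -- 1/n, which leaves 2n + 1 values.
  let code : lowRank M ρ r → K := fun Q => Sum.elim
    (fun p => ⟨⌊(n : ℝ) * U Q (EuclideanSpace.single p.2 1) p.1⌋,
      floor_mul_mem_Icc (abs_entry_le _ (hU Q Q.2) _ _)⟩)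
    (fun p => ⟨⌊(n : ℝ) * V Q (EuclideanSpace.single p.2 1) p.1⌋,
      floor_mul_mem_Icc (abs_entry_le _ ((hV Q Q.2).trans hρ₁) _ _)⟩)
  have : Nonempty (lowRank M ρ r) := ⟨⟨0, zero_mem_lowRank hρ₀ r⟩⟩
  -- One representative inside the class is chosen per occupied cell, since rounding the factors
  -- themselves could increase the norm; an unoccupied cell gets an arbitrary member.
  refine ⟨Finset.univ.image fun κ : K => (Function.invFun code κ : lowRank M ρ r).1, ?_, ?_, ?_⟩
  · intro Q hQ
    obtain ⟨κ, -, rfl⟩ := Finset.mem_image.1 hQ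
    exact (Function.invFun code κ).2
  · refine Finset.card_image_le.trans ?_
    have : Fintype.card K = (2 * n + 1) ^ (2 * M * r) := by
      simp only [K, Fintype.card_fun, Fintype.card_coe, Fintype.card_sum, Fintype.card_prod,
        Fintype.card_fin, Int.card_Icc]
      congr 1
      · omega
      · ring
    rw [Finset.card_univ, this]
  · intro Q hQ
    set Q' : lowRank M ρ r := Function.invFun code (code ⟨Q, hQ⟩) with hQ'
    refine ⟨Q', Finset.mem_image_of_mem _ (Finset.mem_univ _), ?_⟩
    have hcode : code Q' = code ⟨Q, hQ⟩ := Function.invFun_eq ⟨⟨Q, hQ⟩, rfl⟩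
    have hu : ‖U Q - U Q'‖ ≤ Real.sqrt (r * M) * (1 / n) := by
      refine norm_le_of_entries_le _ (by positivity) fun i j => ?_
      have := congrArg Subtype.val (congrFun hcode (Sum.inl (i, j)))
      exact abs_sub_le_of_floor_eq hn this.symm
    have hv : ‖V Q - V Q'‖ ≤ Real.sqrt (M * r) * (1 / n) := by
      refine norm_le_of_entries_le _ (by positivity) fun i j => ?_
      have := congrArg Subtype.val (congrFun hcode (Sum.inr (i, j)))
      exact abs_sub_le_of_floor_eq hn this.symm
    have e : Matrix.toEuclideanCLM (𝕜 := ℝ) (Q - Q'.1) =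
        (U Q - U Q') ∘L V Q + U Q' ∘L (V Q - V Q') := by
      rw [map_sub, hUV Q hQ, hUV Q' Q'.2]
      ext1 x
      simp
    unfold schattenInf
    rw [e]
    calc ‖(U Q - U Q') ∘L V Q + U Q' ∘L (V Q - V Q')‖
        ≤ ‖U Q - U Q'‖ * ‖V Q‖ + ‖U Q'‖ * ‖V Q - V Q'‖ :=
          (norm_add_le _ _).trans (add_le_add (ContinuousLinearMap.opNorm_comp_le _ _)
            (ContinuousLinearMap.opNorm_comp_le _ _))
      _ ≤ (Real.sqrt (r * M) * (1 / n)) * 1 + 1 * (Real.sqrt (M * r) * (1 / n)) := by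
          gcongr
          · exact (hV Q hQ).trans hρ₁
          · exact hU Q' Q'.2
      _ = _ := by rw [mul_comm (r : ℝ) M]; ring

end Matrices

/-! ### Chernoff bounds at a prescribed rate -/

section Chernoff

variable {E : Type*} [NormedAddCommGroup E] [NormedSpace ℝ E] [MeasurableSpace E] [BorelSpace E]
  [SecondCountableTopology E] {Ω : Type*} [MeasurableSpace Ω] {μ : Measure Ω}
  [IsProbabilityMeasure μ] {P ν : Measure E} [IsProbabilityMeasure P] [IsProbabilityMeasure ν]
  {A : E →L[ℝ] E} {x ζ : ℕ → Ω → E} {ρ s D : ℝ} {f : E → E → ℝ} {α β : ℝ}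

omit [SecondCountableTopology E] in
omit [BorelSpace E] in
theorem PairLipschitz.const_mul (hf : PairLipschitz A f α β) {t : ℝ} (ht : 0 ≤ t) :
    PairLipschitz A (fun x y => t * f x y) (t * α) (t * β) where
  measurable := hf.measurable.const_mul t
  nonneg_next := mul_nonneg ht hf.nonneg_next
  nonneg_step := mul_nonneg ht hf.nonneg_step
  next x y y' := by
    rw [← mul_sub, abs_mul, abs_of_nonneg ht, mul_assoc]
    exact mul_le_mul_of_nonneg_left (hf.next x y y') ht
  step x x' z := by
    rw [← mul_sub, abs_mul, abs_of_nonneg ht, mul_assoc]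
    exact mul_le_mul_of_nonneg_left (hf.step x x' z) ht

/-- Sub-Gaussian deviations of an additive functional in the range where the Chernoff
parameter is admissible. -/
theorem PairLipschitz.measure_deviation_le (hf : PairLipschitz A f α β)
    (h : StationaryLaw P ν A ρ s D) (hc : StationaryChain μ P ν A x ζ) {g W q κ : ℝ} (hg : 0 < g)
    (hαβ : α + β / (1 - ρ) ≤ g / (1 - ρ)) (hβ : β ≤ g) (hW : 0 < W)
    (hDW : 16 * (D / s ^ 2 * ((2 - ρ) / (1 - ρ) ^ 3)) ≤ W) (hq : 0 < q)
    (hqW : 16 * q ≤ W * (s * (1 - ρ)) ^ 2) (k : ℕ) :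
    μ {ω | k * ∫ p, f p.1 (A p.1 + p.2) ∂(P.prod ν) + k * (κ * g * Real.sqrt (W * q)) ≤
        pairSum f x k ω} ≤ ENNReal.ofReal (Real.exp (-(4 * κ - 1) * (k * q))) := by
  have hρ : 0 < 1 - ρ := by linarith [h.lt_one]
  have hs := h.scale_pos
  -- With this choice the variance term costs at most q per step, because γ² W/16 = q, while the
  -- deviation gains 4κq; this gives the exponent 4κ - 1. The hypothesis on 16 q is the
  -- admissibility γ/(1-ρ) ≤ s.
  set γ := 4 * Real.sqrt (q / W) with hγ
  have hγ2 : γ ^ 2 = 16 * (q / W) := by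
    rw [hγ, mul_pow, Real.sq_sqrt (by positivity)]; norm_num
  have hγ0 : 0 < γ := by positivity
  set t := γ / g with ht
  have ht0 : 0 < t := by positivity
  have htg : t * g = γ := by rw [ht]; field_simp
  have h1 : t * α + t * β / (1 - ρ) ≤ γ / (1 - ρ) := by
    calc t * α + t * β / (1 - ρ) = t * (α + β / (1 - ρ)) := by ring
      _ ≤ t * (g / (1 - ρ)) := by gcongr
      _ = γ / (1 - ρ) := by rw [← htg]; ring
  have h2 : t * β ≤ γ := by rw [← htg]; gcongr
  have h3 : γ / (1 - ρ) ≤ s := by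
    rw [div_le_iff₀ hρ]
    apply le_of_sq_le_sq _ (by positivity)
    rw [hγ2, mul_div_assoc', div_le_iff₀ hW]
    linarith
  have key := (hf.const_mul ht0.le).measure_pairSum_ge_le h hc h1 h2 h3 k
    (t * (k * (κ * g * Real.sqrt (W * q))))
  have hset : {ω | k * ∫ p, f p.1 (A p.1 + p.2) ∂(P.prod ν) + k * (κ * g * Real.sqrt (W * q)) ≤
      pairSum f x k ω} = {ω | k * ∫ p, t * f p.1 (A p.1 + p.2) ∂(P.prod ν) +
      t * (k * (κ * g * Real.sqrt (W * q))) ≤ pairSum (fun x y => t * f x y) x k ω} := by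
    ext ω
    simp only [Set.mem_ofPred_eq, pairSum]
    rw [integral_const_mul, ← Finset.mul_sum, mul_left_comm (k : ℝ) t, ← mul_add t,
      mul_le_mul_iff_right₀ ht0]
  rw [hset]
  refine key.trans (ENNReal.ofReal_le_ofReal (Real.exp_le_exp.2 ?_))
  have e1 : Real.sqrt (q / W) * Real.sqrt (W * q) = q := by
    rw [← Real.sqrt_mul (by positivity), show q / W * (W * q) = q ^ 2 by field_simp,
      Real.sqrt_sq hq.le]
  have e2 : t * (k * (κ * g * Real.sqrt (W * q))) = 4 * κ * (k * q) := by
    calc t * (k * (κ * g * Real.sqrt (W * q))) = (t * g) * Real.sqrt (W * q) * (k * κ) := by ring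
      _ = 4 * (Real.sqrt (q / W) * Real.sqrt (W * q)) * (k * κ) := by rw [htg, hγ]; ring
      _ = _ := by rw [e1]; ring
  rw [e2, hγ2]
  have e3 : k * (16 * (q / W)) * (D / s ^ 2 * ((2 - ρ) / (1 - ρ) ^ 3)) ≤ k * q := by
    calc k * (16 * (q / W)) * (D / s ^ 2 * ((2 - ρ) / (1 - ρ) ^ 3))
        = k * (q / W) * (16 * (D / s ^ 2 * ((2 - ρ) / (1 - ρ) ^ 3))) := by ring
      _ ≤ k * (q / W) * W := by gcongr
      _ = k * q := by field_simp
  linarith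

end Chernoff

/-! ### Joint independence from nested independence -/

section Independence

variable {Ω α β γ : Type*} [MeasurableSpace Ω] [MeasurableSpace α] [MeasurableSpace β]
  [MeasurableSpace γ] {μ : Measure Ω} [IsProbabilityMeasure μ]

theorem indepFun_prodMk_of_indepFun {X : Ω → α} {Z : Ω → β} {W : Ω → γ} (hX : Measurable X)
    (hZ : Measurable Z) (hW : Measurable W) (h : IndepFun X (fun ω => (Z ω, W ω)) μ)
    (hZW : IndepFun Z W μ) : IndepFun (fun ω => (X ω, Z ω)) W μ := by
  have hXZ : IndepFun X Z μ := h.comp measurable_id measurable_fst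
  have := Measure.isProbabilityMeasure_map (μ := μ) hX.aemeasurable
  have := Measure.isProbabilityMeasure_map (μ := μ) hZ.aemeasurable
  have := Measure.isProbabilityMeasure_map (μ := μ) hW.aemeasurable
  rw [indepFun_iff_map_prod_eq_prod_map_map (hX.prodMk hZ).aemeasurable hW.aemeasurable,
    hXZ.map_prod_eq_prod_map_map hX.aemeasurable hZ.aemeasurable]
  have e : (fun ω => ((X ω, Z ω), W ω)) =
      MeasurableEquiv.prodAssoc.symm ∘ fun ω => (X ω, (Z ω, W ω)) := rfl
  rw [e, ← Measure.map_map MeasurableEquiv.prodAssoc.symm.measurable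
    (hX.prodMk (hZ.prodMk hW)),
    h.map_prod_eq_prod_map_map hX.aemeasurable (hZ.prodMk hW).aemeasurable,
    hZW.map_prod_eq_prod_map_map hZ.aemeasurable hW.aemeasurable]
  rw [← Measure.prodAssoc_prod, MeasurableEquiv.map_symm_map]

end Independence

/-! ### The autoregressive model as a stationary chain -/

section Model

variable {c d ρ : ℝ} {M n r₀ : ℕ} {Ω : Type*} [MeasurableSpace Ω] {μ : Measure Ω}
  [IsProbabilityMeasure μ] {A : Mat M} {X ξ : ℕ → Ω → Vec M} {ℓ : Vec M → ℝ}

omit [IsProbabilityMeasure μ] in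
theorem IsStationaryVAR.map_state (h : IsStationaryVAR μ A X ξ) (k : ℕ) :
    μ.map (X (k + 1)) = μ.map (X 1) := by
  have h1 := (h.stationary k).comp (measurable_pi_apply (0 : ℕ))
  have h2 := h1.map_eq
  rw [add_comm k 1]
  exact (by simpa [Function.comp_def] using h2)

theorem IsStationaryVAR.stationaryChain (h : IsStationaryVAR μ A X ξ) :
    StationaryChain μ (μ.map (X 1)) (μ.map (ξ 2)) (Matrix.toEuclideanCLM (𝕜 := ℝ) A)
      (fun k => X (k + 1)) (fun k => ξ (k + 2)) where
  measurable_state k := h.measurable_X _ (by omega)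
  measurable_noise k := h.measurable_noise _ (by omega)
  law_state k := h.map_state k
  law_noise k := (h.noise_identDistrib _ (by omega)).map_eq
  recursion k := h.recursion (k + 1) (by omega)
  indep k := by
    have hm : ∀ i, Measurable (ξ (i + 2)) := fun i => h.measurable_noise _ (by omega)
    refine indepFun_prodMk_of_indepFun (h.measurable_X 1 le_rfl) (by fun_prop) (hm k) ?_ ?_
    · exact h.init_indep.comp measurable_id
        (φ := id) (ψ := fun z : ℕ → Vec M => ((fun i : Finset.range k => z i), z k)) (by fun_prop)
    · have := h.noise_indep.indepFun_finset (Finset.range k) {k} (by simp) hm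
      exact this.comp measurable_id
        (φ := id) (ψ := fun z : ({k} : Finset ℕ) → Vec M => z ⟨k, by simp⟩) (by fun_prop)

/-- With the scale 1/(√M c) the scaled Euclidean norm is the quadratic mean of the |z j|/c, so power
means apply and the bound on the moment does not grow with the dimension. -/
theorem expRem_le_sum_exp (hM : 1 ≤ M) (hc : 0 < c) (z : Vec M) :
    expRem ((Real.sqrt M * c)⁻¹ * ‖z‖) ≤ ∑ j, (M : ℝ)⁻¹ * Real.exp (|z j| / c) := by
  have : Nonempty (Fin M) := ⟨⟨0, hM⟩⟩
  have h1 := expRem_sqrt_mean_sq_le (fun j : Fin M => |z j| / c) (fun j => by positivity)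
  have e : (Real.sqrt M * c)⁻¹ * ‖z‖ =
      Real.sqrt (∑ j, (Fintype.card (Fin M) : ℝ)⁻¹ * (|z j| / c) ^ 2) := by
    have hM' : (0 : ℝ) < M := by exact_mod_cast hM
    symm
    rw [Real.sqrt_eq_iff_mul_self_eq (Finset.sum_nonneg fun j _ => by positivity) (by positivity),
      ← pow_two, mul_pow, inv_pow, mul_pow, Real.sq_sqrt hM'.le, EuclideanSpace.real_norm_sq_eq,
      ← Finset.mul_sum]
    simp only [div_pow, sq_abs, Fintype.card_fin]
    rw [← Finset.sum_div]
    field_simp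
  rw [e]
  refine h1.trans (Finset.sum_le_sum fun j _ => ?_)
  rw [Fintype.card_fin]
  gcongr
  have : 0 ≤ |z j| / c := by positivity
  unfold expRem
  linarith

omit [IsProbabilityMeasure μ] in
theorem HasExpMoments.integrable_exp (hξ : HasExpMoments μ ξ c d)
    (hm : Measurable (ξ 2)) (j : Fin M) : Integrable (fun ω => Real.exp (|ξ 2 ω j| / c)) μ := by
  refine ⟨(by fun_prop : Measurable _).aestronglyMeasurable, ?_⟩
  rw [hasFiniteIntegral_iff_ofReal (ae_of_all _ fun _ => (Real.exp_pos _).le)]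
  exact (hξ 2 le_rfl j).trans_lt ENNReal.ofReal_lt_top

omit [IsProbabilityMeasure μ] in
theorem HasExpMoments.integral_exp_le (hξ : HasExpMoments μ ξ c d) (hd : 0 < d)
    (hm : Measurable (ξ 2)) (j : Fin M) : ∫ ω, Real.exp (|ξ 2 ω j| / c) ∂μ ≤ d := by
  have h := hξ 2 le_rfl j
  rwa [← ofReal_integral_eq_lintegral_ofReal (hξ.integrable_exp hm j)
    (ae_of_all _ fun _ => (Real.exp_pos _).le), ENNReal.ofReal_le_ofReal_iff hd.le] at h

/-- The exponential is at least 1. Needed for the admissibility of the Chernoff parameter when only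
`logRate` ≤ 1 is known. -/
theorem HasExpMoments.one_le (hξ : HasExpMoments μ ξ c d) (hc : 0 < c) (hd : 0 < d)
    (hm : Measurable (ξ 2)) (hM : 1 ≤ M) : 1 ≤ d := by
  refine le_trans ?_ (hξ.integral_exp_le hd hm ⟨0, hM⟩)
  have : ∫ _, (1 : ℝ) ∂μ = 1 := by simp
  rw [← this]
  exact integral_mono (integrable_const _) (hξ.integrable_exp hm _) fun ω =>
    Real.one_le_exp (by positivity)

omit [IsProbabilityMeasure μ] in
theorem Assumptions.one_le_dim (h : Assumptions c d ρ n r₀ μ A X ξ ℓ) : 1 ≤ M :=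
  h.rank_range.1.trans h.rank_range.2

/-- The exponential moment scale of the noise vector. -/
def noiseScale (M : ℕ) (c : ℝ) : ℝ := (Real.sqrt M * c)⁻¹

theorem Assumptions.stationaryLaw (h : Assumptions c d ρ n r₀ μ A X ξ ℓ) (hc : 0 < c)
    (hd : 0 < d) (hρ₀ : 0 < ρ) (hρ₁ : ρ < 1) :
    StationaryLaw (μ.map (X 1)) (μ.map (ξ 2)) (Matrix.toEuclideanCLM (𝕜 := ℝ) A) ρ
      (noiseScale M c) d := by
  have hM := h.one_le_dim
  have hM' : (0 : ℝ) < M := by exact_mod_cast hM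
  have hm := h.process.measurable_noise 2 le_rfl
  have := Measure.isProbabilityMeasure_map (μ := μ) hm.aemeasurable
  have := Measure.isProbabilityMeasure_map (μ := μ) (h.process.measurable_X 1 le_rfl).aemeasurable
  have hg : Integrable (fun ω => ∑ j, (M : ℝ)⁻¹ * Real.exp (|ξ 2 ω j| / c)) μ :=
    integrable_finsetSum _ fun j _ => (h.noise.integrable_exp hm j).const_mul _
  have hmeas : Measurable fun z : Vec M => expRem (noiseScale M c * ‖z‖) :=
    continuous_expRem.measurable.comp (by fun_prop)
  have hi : Integrable (fun ω => expRem (noiseScale M c * ‖ξ 2 ω‖)) μ := by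
    refine hg.mono' (hmeas.comp hm).aestronglyMeasurable (ae_of_all _ fun ω => ?_)
    rw [Real.norm_of_nonneg (expRem_nonneg _)]
    exact expRem_le_sum_exp hM hc _
  refine ⟨hρ₀, hρ₁, h.mem_lowRank.2, by unfold noiseScale; positivity, ?_, ?_,
    h.process.stationaryChain.map_step⟩
  · rw [integrable_map_measure hmeas.aestronglyMeasurable hm.aemeasurable]
    exact hi
  · rw [integral_map hm.aemeasurable hmeas.aestronglyMeasurable]
    refine (integral_mono hi hg fun ω => expRem_le_sum_exp hM hc _).trans ?_
    rw [integral_finsetSum _ fun j _ => (h.noise.integrable_exp hm j).const_mul _]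
    calc ∑ j, ∫ ω, (M : ℝ)⁻¹ * Real.exp (|ξ 2 ω j| / c) ∂μ ≤ ∑ _j : Fin M, (M : ℝ)⁻¹ * d := by
          refine Finset.sum_le_sum fun j _ => ?_
          rw [integral_const_mul]
          gcongr
          exact h.noise.integral_exp_le hd hm j
      _ = d := by simp; field_simp

end Model

/-! ### Constants and rates -/

section Constants

variable {c d ρ : ℝ}

theorem V0_ge (hc : 0 < c) (hd : 0 < d) (hρ₁ : ρ < 1) :
    16 * (c ^ 2 * d * ((2 - ρ) / (1 - ρ) ^ 3)) ≤ V0 c d ρ := by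
  have hρ : 0 < 1 - ρ := by linarith
  have hρ2 : 0 < 2 - ρ := by linarith
  have he : (2 : ℝ) ≤ Real.exp 1 := by linarith [Real.add_one_le_exp (1 : ℝ)]
  unfold V0
  rw [show 16 * (c ^ 2 * d * ((2 - ρ) / (1 - ρ) ^ 3)) =
    8 * 2 * c ^ 2 * d * (2 - ρ) / (1 - ρ) ^ 3 by ring]
  gcongr

/-- 2 - ρ ≥ 2(1 - ρ), which trades one power of 1 - ρ for a factor 2. -/
theorem V0_ge' (hc : 0 < c) (hd : 0 < d) (hρ₀ : 0 < ρ) (hρ₁ : ρ < 1) :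
    32 * (c ^ 2 * d) / (1 - ρ) ^ 2 ≤ V0 c d ρ := by
  refine le_trans ?_ (V0_ge hc hd hρ₁)
  have hρ : 0 < 1 - ρ := by linarith
  have e : 32 * (c ^ 2 * d) / (1 - ρ) ^ 2 =
      16 * (c ^ 2 * d * (2 * (1 - ρ) / (1 - ρ) ^ 3)) := by
    field_simp; norm_num
  rw [e]
  gcongr
  linarith

theorem V0_pos (hc : 0 < c) (hd : 0 < d) (hρ₁ : ρ < 1) : 0 < V0 c d ρ := by
  have hρ : 0 < 1 - ρ := by linarith
  have hρ2 : 0 < 2 - ρ := by linarith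
  unfold V0
  positivity

/-- The exponent `M r log(9 r n) / (n - 1)`. -/
def logRate (M n r : ℕ) : ℝ := M * r * Real.log (9 * r * n) / ((n : ℝ) - 1)

theorem one_le_log {n r : ℕ} (hr : 1 ≤ r) (hn : 1 ≤ n) : 1 ≤ Real.log (9 * r * n) := by
  have hr' : (1 : ℝ) ≤ r := by exact_mod_cast hr
  have hn' : (1 : ℝ) ≤ n := by exact_mod_cast hn
  rw [Real.le_log_iff_exp_le (by positivity)]
  have h1 : (1 : ℝ) ≤ r * n := one_le_mul_of_one_le_of_one_le hr' hn'
  linarith [Real.exp_one_lt_d9, mul_assoc (9 : ℝ) r n]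

theorem logRate_pos {M n r : ℕ} (hM : 1 ≤ M) (hr : 1 ≤ r) (hn : 2 ≤ n) : 0 < logRate M n r := by
  have hM' : (1 : ℝ) ≤ M := by exact_mod_cast hM
  have hr' : (1 : ℝ) ≤ r := by exact_mod_cast hr
  have hn' : (2 : ℝ) ≤ n := by exact_mod_cast hn
  have := one_le_log hr (by omega : 1 ≤ n)
  unfold logRate
  have : 0 < (n : ℝ) - 1 := by linarith
  positivity

theorem logRate_mono {M n r r' : ℕ} (hn : 2 ≤ n) (hr : 1 ≤ r) (hrr : r ≤ r') :
    logRate M n r ≤ logRate M n r' := by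
  have hn' : (2 : ℝ) ≤ n := by exact_mod_cast hn
  have : 0 < (n : ℝ) - 1 := by linarith
  have hr' : (1 : ℝ) ≤ r := by exact_mod_cast hr
  have hl := one_le_log hr (by omega : 1 ≤ n)
  unfold logRate
  gcongr

theorem sub_one_mul_logRate {M n r : ℕ} (hn : 2 ≤ n) :
    ((n - 1 : ℕ) : ℝ) * logRate M n r = M * r * Real.log (9 * r * n) := by
  have hn' : (2 : ℝ) ≤ n := by exact_mod_cast hn
  have : (n : ℝ) - 1 ≠ 0 := by linarith
  rw [Nat.cast_sub (by omega), Nat.cast_one]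
  unfold logRate
  field_simp

theorem exp_neg_mul_logRate {M n r : ℕ} (hn : 2 ≤ n) (hr : 1 ≤ r) (k : ℕ) :
    Real.exp (-k * (((n - 1 : ℕ) : ℝ) * logRate M n r)) =
      ((9 * r * n : ℝ) ^ (k * (M * r)))⁻¹ := by
  have hr' : (0 : ℝ) < r := by exact_mod_cast hr
  have hn' : (0 : ℝ) < n := by exact_mod_cast (by omega : 0 < n)
  rw [sub_one_mul_logRate hn, neg_mul, Real.exp_neg,
    show (k : ℝ) * (M * r * Real.log (9 * r * n)) =
      ((k * (M * r) : ℕ) : ℝ) * Real.log (9 * r * n) by push_cast; ring,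
    Real.exp_nat_mul, Real.exp_log (by positivity)]

theorem rankTerm_eq (c d ρ : ℝ) (M n r : ℕ) :
    rankTerm c d ρ M n r = 2 * Real.sqrt (M * V0 c d ρ * logRate M n r) := by
  have e : 4 * V0 c d ρ * (M : ℝ) ^ 2 * r * Real.log (9 * r * n) / ((n : ℝ) - 1) =
      2 ^ 2 * (M * V0 c d ρ * logRate M n r) := by
    unfold logRate; ring
  rw [rankTerm, e, Real.sqrt_mul (by norm_num), Real.sqrt_sq (by norm_num)]

theorem rankTerm_nonneg (c d ρ : ℝ) (M n r : ℕ) : 0 ≤ rankTerm c d ρ M n r :=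
  Real.sqrt_nonneg _

end Constants

/-! ### Risks, their Lipschitz dependence on the matrix, and minimizers -/

section Risk

variable {c d ρ : ℝ} {M n r₀ : ℕ} {Ω : Type*} [MeasurableSpace Ω] {μ : Measure Ω}
  [IsProbabilityMeasure μ] {A : Mat M} {X ξ : ℕ → Ω → Vec M} {ℓ : Vec M → ℝ}

theorem sum_Icc_two (f : ℕ → ℝ) (n : ℕ) :
    ∑ i ∈ Finset.Icc 2 n, f i = ∑ i ∈ Finset.range (n - 1), f (i + 2) := by
  refine Finset.sum_nbij' (fun i => i - 2) (fun i => i + 2) ?_ ?_ ?_ ?_ ?_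
  · intro i hi; simp at hi ⊢; omega
  · intro i hi; simp at hi ⊢; omega
  · intro i hi; simp at hi; omega
  · intro i hi; simp
  · intro i hi
    have := (Finset.mem_Icc.1 hi).1
    rw [Nat.sub_add_cancel this]

/-- The empirical mean of the norms of the regressors. -/
def meanNorm {M : ℕ} (n : ℕ) (x : ℕ → Vec M) : ℝ :=
  1 / ((n : ℝ) - 1) * ∑ i ∈ Finset.Icc 2 n, ‖x (i - 1)‖

theorem meanNorm_nonneg {n : ℕ} (hn : 2 ≤ n) (x : ℕ → Vec M) : 0 ≤ meanNorm n x := by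
  have hn' : (2 : ℝ) ≤ n := by exact_mod_cast hn
  have : 0 < (n : ℝ) - 1 := by linarith
  unfold meanNorm
  positivity

theorem continuous_loss (hℓ : ∀ x y, |ℓ x - ℓ y| ≤ ‖x - y‖) : Continuous ℓ :=
  continuous_of_abs_sub_le zero_le_one (by simpa using hℓ)

theorem continuous_act (Q : Mat M) : Continuous (act Q) :=
  (Matrix.toEuclideanCLM (𝕜 := ℝ) Q).continuous

omit [IsProbabilityMeasure μ] in
theorem Assumptions.loss_abs_sub_le (h : Assumptions c d ρ n r₀ μ A X ξ ℓ) (x y : Vec M) :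
    |ℓ x - ℓ y| ≤ ‖x - y‖ := by
  obtain ⟨L, hL, hℓ⟩ := h.loss
  have h1 := hℓ.dist_le_mul x y
  rw [Real.dist_eq, dist_eq_norm] at h1
  have h2 : (L : ℝ) ≤ 1 := by exact_mod_cast hL
  exact h1.trans (mul_le_of_le_one_left (norm_nonneg _) h2)

theorem abs_loss_sub_le (hℓ : ∀ x y, |ℓ x - ℓ y| ≤ ‖x - y‖) (Q Q' : Mat M) (y x : Vec M) :
    |ℓ (y - act Q x) - ℓ (y - act Q' x)| ≤ schattenInf (Q - Q') * ‖x‖ := by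
  refine (hℓ _ _).trans ?_
  rw [sub_sub_sub_cancel_left, ← norm_neg, neg_sub, ← act_sub]
  exact norm_act_le _ _

theorem abs_empError_sub_le (hℓ : ∀ x y, |ℓ x - ℓ y| ≤ ‖x - y‖) {n : ℕ} (hn : 2 ≤ n)
    (x : ℕ → Vec M) (Q Q' : Mat M) :
    |empError ℓ n x Q - empError ℓ n x Q'| ≤ schattenInf (Q - Q') * meanNorm n x := by
  have hn' : (2 : ℝ) ≤ n := by exact_mod_cast hn
  have hn1 : 0 < 1 / ((n : ℝ) - 1) := by
    have : 0 < (n : ℝ) - 1 := by linarith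
    positivity
  unfold empError meanNorm
  rw [← mul_sub, abs_mul, abs_of_pos hn1, ← Finset.sum_sub_distrib, mul_left_comm, Finset.mul_sum]
  gcongr
  exact (Finset.abs_sum_le_sum_abs _ _).trans
    (Finset.sum_le_sum fun i _ => abs_loss_sub_le hℓ Q Q' _ _)

theorem Assumptions.isProbabilityMeasure_state (h : Assumptions c d ρ n r₀ μ A X ξ ℓ) :
    IsProbabilityMeasure (μ.map (X 1)) :=
  Measure.isProbabilityMeasure_map (h.process.measurable_X 1 le_rfl).aemeasurable

theorem Assumptions.isProbabilityMeasure_noise (h : Assumptions c d ρ n r₀ μ A X ξ ℓ) :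
    IsProbabilityMeasure (μ.map (ξ 2)) :=
  Measure.isProbabilityMeasure_map (h.process.measurable_noise 2 le_rfl).aemeasurable

theorem Assumptions.integrable_norm (h : Assumptions c d ρ n r₀ μ A X ξ ℓ) (hc : 0 < c)
    (hd : 0 < d) (hρ₀ : 0 < ρ) (hρ₁ : ρ < 1) {t : ℕ} (ht : 1 ≤ t) :
    Integrable (fun ω => ‖X t ω‖) μ := by
  have := h.isProbabilityMeasure_state
  have := h.isProbabilityMeasure_noise
  obtain ⟨k, rfl⟩ := Nat.exists_eq_add_of_le' ht
  have h1 := (h.stationaryLaw hc hd hρ₀ hρ₁).integrable_norm_state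
  rw [← h.process.map_state k] at h1
  exact h1.comp_measurable (h.process.measurable_X _ ht)

theorem noiseScale_mul_sq (hM : 1 ≤ M) (u : ℝ) :
    (noiseScale M c * u) ^ 2 = u ^ 2 / (M * c ^ 2) := by
  have hM' : (0 : ℝ) ≤ M := by positivity
  rw [noiseScale, mul_pow, inv_pow, mul_pow, Real.sq_sqrt hM']
  ring

/-- Puts the mean norm on the scale √(M V₀) of the rank term, so that Lipschitz errors in Q can be
compared with it. -/
theorem Assumptions.integral_norm_le (h : Assumptions c d ρ n r₀ μ A X ξ ℓ) (hc : 0 < c)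
    (hd : 0 < d) (hρ₀ : 0 < ρ) (hρ₁ : ρ < 1) :
    ∫ ω, ‖X 1 ω‖ ∂μ ≤ Real.sqrt (M * V0 c d ρ) / 4 := by
  have hM := h.one_le_dim
  have hM' : (0 : ℝ) < M := by exact_mod_cast hM
  have hρ : 0 < 1 - ρ := by linarith
  have := h.isProbabilityMeasure_state
  have := h.isProbabilityMeasure_noise
  have h1 := (h.stationaryLaw hc hd hρ₀ hρ₁).integral_norm_state_le
  rw [integral_map (h.process.measurable_X 1 le_rfl).aemeasurable
    (by fun_prop : Measurable fun x : Vec M => ‖x‖).aestronglyMeasurable] at h1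
  refine h1.trans ?_
  have hV := V0_ge' hc hd hρ₀ hρ₁
  have hs : 0 < noiseScale M c := by unfold noiseScale; positivity
  rw [div_le_div_iff₀ (mul_pos hs hρ) (by norm_num)]
  apply le_of_sq_le_sq _ (by positivity)
  rw [mul_pow, mul_pow, Real.sq_sqrt (by positivity), Real.sq_sqrt
    (mul_nonneg hM'.le (V0_pos hc hd hρ₁).le), noiseScale_mul_sq hM]
  rw [div_le_iff₀ (by positivity)] at hV
  have e : M * V0 c d ρ * ((1 - ρ) ^ 2 / (M * c ^ 2)) = V0 c d ρ * (1 - ρ) ^ 2 / c ^ 2 := by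
    field_simp
  rw [e, le_div_iff₀ (by positivity)]
  linarith

theorem Assumptions.integrable_loss (h : Assumptions c d ρ n r₀ μ A X ξ ℓ) (hc : 0 < c)
    (hd : 0 < d) (hρ₀ : 0 < ρ) (hρ₁ : ρ < 1) (Q : Mat M) {t : ℕ} (ht : 2 ≤ t) :
    Integrable (fun ω => ℓ (X t ω - act Q (X (t - 1) ω))) μ := by
  have hℓ := h.loss_abs_sub_le
  have hm1 := h.process.measurable_X t (by omega)
  have hm2 := h.process.measurable_X (t - 1) (by omega)
  have hmeas : Measurable (fun ω => ℓ (X t ω - act Q (X (t - 1) ω))) :=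
    (continuous_loss hℓ).measurable.comp (hm1.sub ((continuous_act Q).measurable.comp hm2))
  refine Integrable.mono' (((integrable_const |ℓ 0|).add
    (h.integrable_norm hc hd hρ₀ hρ₁ (t := t) (by omega))).add
    ((h.integrable_norm hc hd hρ₀ hρ₁ (t := t - 1) (by omega)).const_mul (schattenInf Q)))
    hmeas.aestronglyMeasurable (ae_of_all _ fun ω => ?_)
  have h1 := hℓ (X t ω - act Q (X (t - 1) ω)) 0
  rw [sub_zero] at h1
  have h2 := abs_sub_abs_le_abs_sub (ℓ (X t ω - act Q (X (t - 1) ω))) (ℓ 0)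
  have h3 := norm_sub_le (X t ω) (act Q (X (t - 1) ω))
  have h4 := norm_act_le Q (X (t - 1) ω)
  simp only [Real.norm_eq_abs, Pi.add_apply]
  linarith

omit [IsProbabilityMeasure μ] in
theorem Assumptions.integral_loss_eq (h : Assumptions c d ρ n r₀ μ A X ξ ℓ) (Q : Mat M)
    {t : ℕ} (ht : 2 ≤ t) :
    ∫ ω, ℓ (X t ω - act Q (X (t - 1) ω)) ∂μ = genError μ ℓ X Q := by
  obtain ⟨k, rfl⟩ := Nat.exists_eq_add_of_le' ht
  have hm : Measurable fun z : ℕ → Vec M => ℓ (z 1 - act Q (z 0)) :=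
    (continuous_loss h.loss_abs_sub_le).measurable.comp ((measurable_pi_apply 1).sub
      ((continuous_act Q).measurable.comp (measurable_pi_apply 0)))
  have := ((h.process.stationary k).comp hm).integral_eq
  simp only [Function.comp_def] at this
  rw [show 1 + 1 + k = k + 2 by omega, show 0 + 1 + k = k + 2 - 1 by omega] at this
  exact this

theorem Assumptions.abs_genError_sub_le (h : Assumptions c d ρ n r₀ μ A X ξ ℓ) (hc : 0 < c)
    (hd : 0 < d) (hρ₀ : 0 < ρ) (hρ₁ : ρ < 1) (Q Q' : Mat M) :
    |genError μ ℓ X Q - genError μ ℓ X Q'| ≤ schattenInf (Q - Q') * ∫ ω, ‖X 1 ω‖ ∂μ := by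
  have hi := fun Q => h.integrable_loss hc hd hρ₀ hρ₁ Q (t := 2) le_rfl
  unfold genError
  rw [← integral_sub (hi Q) (hi Q'), ← integral_const_mul]
  exact abs_integral_le_integral_abs.trans (integral_mono ((hi Q).sub (hi Q')).abs
    ((h.integrable_norm hc hd hρ₀ hρ₁ le_rfl).const_mul _)
    fun ω => abs_loss_sub_le h.loss_abs_sub_le Q Q' _ _)

/-- The risk is Lipschitz in Q with constant E‖X₁‖, and the class is compact and contains 0. -/
theorem Assumptions.exists_minimizer (h : Assumptions c d ρ n r₀ μ A X ξ ℓ) (hc : 0 < c)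
    (hd : 0 < d) (hρ₀ : 0 < ρ) (hρ₁ : ρ < 1) (r : ℕ) :
    IsLeast (genError μ ℓ X '' lowRank M ρ r) (minRisk μ ℓ X ρ r) := by
  set G : (Vec M →L[ℝ] Vec M) → ℝ := fun T =>
    genError μ ℓ X ((Matrix.toEuclideanCLM (𝕜 := ℝ)).symm T) with hG
  have hGQ : ∀ Q : Mat M, G (Matrix.toEuclideanCLM (𝕜 := ℝ) Q) = genError μ ℓ X Q := by
    intro Q; simp [hG]
  have hGc : Continuous G := by
    refine continuous_of_abs_sub_le (a := ∫ ω, ‖X 1 ω‖ ∂μ)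
      (integral_nonneg fun _ => norm_nonneg _) fun T T' => ?_
    refine (h.abs_genError_sub_le hc hd hρ₀ hρ₁ _ _).trans (le_of_eq ?_)
    rw [schattenInf, map_sub, mul_comm]
    simp
  obtain ⟨T, ⟨Q, hQ, rfl⟩, hT⟩ := (isCompact_image_lowRank (M := M) ρ r).exists_isMinOn
    ⟨_, Set.mem_image_of_mem _ (zero_mem_lowRank hρ₀.le r)⟩ hGc.continuousOn
  have hl : IsLeast (genError μ ℓ X '' lowRank M ρ r) (genError μ ℓ X Q) := by
    refine ⟨Set.mem_image_of_mem _ hQ, ?_⟩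
    rintro _ ⟨Q', hQ', rfl⟩
    have := hT (Set.mem_image_of_mem _ hQ')
    simpa only [Set.mem_ofPred_eq, hGQ] using this
  rw [minRisk, hl.csInf_eq]
  exact hl

omit [IsProbabilityMeasure μ] in
theorem isLeast_oracleBound (c d ρ : ℝ) (n : ℕ) (h : 1 ≤ rbar c d ρ M n) :
    IsLeast (oracleValues μ ℓ X c d ρ n) (oracleBound μ ℓ X c d ρ n) := by
  have hfin : (oracleValues μ ℓ X c d ρ n).Finite := (Set.finite_Icc _ _).image _
  have hne : (oracleValues μ ℓ X c d ρ n).Nonempty := (Set.nonempty_Icc.2 h).image _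
  exact ⟨hne.csInf_mem hfin, fun v hv => csInf_le hfin.bddBelow hv⟩

omit [IsProbabilityMeasure μ] in
theorem Assumptions.two_le (h : Assumptions c d ρ n r₀ μ A X ξ ℓ) (hc : 0 < c)
    (hd : 0 < d) (hρ₁ : ρ < 1) : 2 ≤ n := by
  obtain ⟨r, ⟨hr1, hr2⟩, hs⟩ := h.sample_size
  have hM := h.one_le_dim
  have hV := V0_pos hc hd hρ₁
  have hρ : 0 < 1 - ρ := by linarith
  have hδ : 0 < delta0 c ρ := by unfold delta0; positivity
  unfold SampleSizeCond at hs
  rcases Nat.lt_or_ge n 2 with hn | hn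
  · interval_cases n
    · norm_num at hs
    · have hl := one_le_log hr1 le_rfl
      have : 0 < 16 * delta0 c ρ ^ 2 * M * r * Real.log (9 * r * (1 : ℕ)) / V0 c d ρ := by
        have : (0 : ℝ) < M := by exact_mod_cast hM
        have : (0 : ℝ) < r := by exact_mod_cast hr1
        positivity
      push_cast at this hs
      linarith
  · exact hn

omit [IsProbabilityMeasure μ] in
-- The sample-size condition carries the factor M, which is the one in `logRate`; monotonicity then
-- brings its rank down to 1. It makes the Chernoff parameter for the mean norm admissible.
theorem Assumptions.logRate_one_le (h : Assumptions c d ρ n r₀ μ A X ξ ℓ) (hc : 0 < c)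
    (hd : 0 < d) (hρ₁ : ρ < 1) : 64 * c ^ 2 * logRate M n 1 ≤ V0 c d ρ * (1 - ρ) ^ 2 := by
  obtain ⟨r, ⟨hr1, hr2⟩, hs⟩ := h.sample_size
  have hn := h.two_le hc hd hρ₁
  have hn' : (2 : ℝ) ≤ n := by exact_mod_cast hn
  have hn1 : 0 < (n : ℝ) - 1 := by linarith
  have hV := V0_pos hc hd hρ₁
  have hρ : 0 < 1 - ρ := by linarith
  unfold SampleSizeCond delta0 at hs
  have h1 : 16 * (2 * c / (1 - ρ)) ^ 2 * M * r * Real.log (9 * r * n) / V0 c d ρ ≤ (n : ℝ) - 1 := by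
    linarith
  have h2 : 64 * c ^ 2 * logRate M n r ≤ V0 c d ρ * (1 - ρ) ^ 2 := by
    unfold logRate
    rw [mul_div_assoc', div_le_iff₀ hn1]
    rw [div_le_iff₀ hV] at h1
    have e : 16 * (2 * c / (1 - ρ)) ^ 2 * M * r * Real.log (9 * r * n) =
      64 * c ^ 2 * (M * r * Real.log (9 * r * n)) / (1 - ρ) ^ 2 := by
      rw [div_pow]; ring
    rw [e, div_le_iff₀ (by positivity)] at h1
    linarith
  refine le_trans ?_ h2
  gcongr
  exact logRate_mono hn le_rfl hr1

omit [IsProbabilityMeasure μ] in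
theorem Assumptions.rbar_set_nonempty (h : Assumptions c d ρ n r₀ μ A X ξ ℓ) (hc : 0 < c)
    (hd : 0 < d) (hρ₁ : ρ < 1) : 1 ≤ rbar c d ρ M n ∧ rbar c d ρ M n ≤ M := by
  have hn := h.two_le hc hd hρ₁
  have hV := V0_pos hc hd hρ₁
  obtain ⟨r, ⟨hr1, hr2⟩, hs⟩ := h.sample_size
  have hl := one_le_log hr1 (by omega : 1 ≤ n)
  have hM : (1 : ℝ) ≤ M := by exact_mod_cast h.one_le_dim
  have hmem : r ∈ {r : ℕ | 1 ≤ r ∧ r ≤ M ∧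
      1 + 16 * delta0 c ρ ^ 2 * r * Real.log (9 * r * n) / V0 c d ρ ≤ (n : ℝ)} := by
    refine ⟨hr1, hr2, le_trans ?_ hs⟩
    rw [mul_right_comm _ (M : ℝ), mul_right_comm _ (M : ℝ), mul_div_right_comm _ (M : ℝ)]
    gcongr
    exact le_mul_of_one_le_right (by positivity) hM
  have hbdd : BddAbove {r : ℕ | 1 ≤ r ∧ r ≤ M ∧
      1 + 16 * delta0 c ρ ^ 2 * r * Real.log (9 * r * n) / V0 c d ρ ≤ (n : ℝ)} :=
    ⟨M, fun s hs => hs.2.1⟩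
  have := Nat.sSup_mem ⟨r, hmem⟩ hbdd
  exact ⟨this.1, this.2.1⟩

end Risk

theorem StationaryChain.integral_prod_eq {E : Type*} [NormedAddCommGroup E] [NormedSpace ℝ E]
    [MeasurableSpace E] [BorelSpace E] [SecondCountableTopology E] {Ω : Type*}
    [MeasurableSpace Ω] {μ : Measure Ω} [IsProbabilityMeasure μ] {P ν : Measure E}
    [IsProbabilityMeasure P] [IsProbabilityMeasure ν] {A : E →L[ℝ] E} {x ζ : ℕ → Ω → E}
    (hc : StationaryChain μ P ν A x ζ) {f : E → E → ℝ} (hf : Measurable (Function.uncurry f)) :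
    ∫ p, f p.1 (A p.1 + p.2) ∂(P.prod ν) = ∫ ω, f (x 0 ω) (x 1 ω) ∂μ := by
  have hm : Measurable fun p : E × E => f p.1 (A p.1 + p.2) :=
    hf.comp (measurable_fst.prodMk ((by fun_prop : Measurable fun p : E × E => A p.1 + p.2)))
  rw [← hc.map_state_noise 0, integral_map
    ((hc.measurable_state 0).prodMk (hc.measurable_noise 0)).aemeasurable hm.aestronglyMeasurable]
  refine integral_congr_ae ?_
  filter_upwards [hc.recursion 0] with ω hω
  rw [hω]

/-! ### Uniform deviations of the empirical risk -/

section Deviations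

variable {c d ρ : ℝ} {M n r₀ : ℕ} {Ω : Type*} [MeasurableSpace Ω] {μ : Measure Ω}
  [IsProbabilityMeasure μ] {A : Mat M} {X ξ : ℕ → Ω → Vec M} {ℓ : Vec M → ℝ}

/-- The residual A x + z - Q x depends on the state through A - Q, whose norm is at most 2ρ. -/
theorem pairLipschitz_loss {ℓ' : Vec M → ℝ} (hℓ : ∀ x y, |ℓ' x - ℓ' y| ≤ ‖x - y‖) (hρ₀ : 0 ≤ ρ)
    {A Q : Mat M} (hA : schattenInf A ≤ ρ) (hQ : schattenInf Q ≤ ρ) :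
    PairLipschitz (Matrix.toEuclideanCLM (𝕜 := ℝ) A) (fun x y => ℓ' (y - act Q x)) 1 (2 * ρ) where
  measurable := by
    have : Continuous fun p : Vec M × Vec M => ℓ' (p.2 - act Q p.1) :=
      (continuous_loss hℓ).comp (continuous_snd.sub ((continuous_act Q).comp continuous_fst))
    exact this.measurable
  nonneg_next := zero_le_one
  nonneg_step := by positivity
  next x y y' := by simpa using hℓ (y - act Q x) (y' - act Q x)
  step x x' z := by
    refine (hℓ _ _).trans ?_
    have e : Matrix.toEuclideanCLM (𝕜 := ℝ) A x + z - act Q x -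
        (Matrix.toEuclideanCLM (𝕜 := ℝ) A x' + z - act Q x') = act (A - Q) (x - x') := by
      simp only [act, map_sub, _root_.sub_apply]
      abel
    rw [e]
    refine (norm_act_le _ _).trans (mul_le_mul_of_nonneg_right ?_ (norm_nonneg _))
    linarith [schattenInf_sub_le A Q]

theorem pairLipschitz_norm (A : Mat M) :
    PairLipschitz (Matrix.toEuclideanCLM (𝕜 := ℝ) A) (fun x _ => ‖x‖) 0 1 where
  measurable := measurable_fst.norm
  nonneg_next := le_rfl
  nonneg_step := zero_le_one
  next x y y' := by simp
  step x x' z := by simpa using abs_norm_sub_norm_le x x'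

theorem sixteen_mul_noiseScale_le (hM : 1 ≤ M) (hc : 0 < c) (hd : 0 < d) (hρ₁ : ρ < 1) :
    16 * (d / noiseScale M c ^ 2 * ((2 - ρ) / (1 - ρ) ^ 3)) ≤ M * V0 c d ρ := by
  have hM' : (0 : ℝ) < M := by exact_mod_cast hM
  have h1 := noiseScale_mul_sq (c := c) hM 1
  rw [mul_one, one_pow] at h1
  rw [h1, div_div_eq_mul_div, div_one]
  calc 16 * (d * (M * c ^ 2) * ((2 - ρ) / (1 - ρ) ^ 3))
      = M * (16 * (c ^ 2 * d * ((2 - ρ) / (1 - ρ) ^ 3))) := by ring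
    _ ≤ _ := by gcongr; exact V0_ge hc hd hρ₁

theorem admissible_rate (hM : 1 ≤ M) (hc : 0 < c) {q : ℝ}
    (hq : 16 * c ^ 2 * q ≤ V0 c d ρ * (1 - ρ) ^ 2) :
    16 * q ≤ M * V0 c d ρ * (noiseScale M c * (1 - ρ)) ^ 2 := by
  have hM' : (0 : ℝ) < M := by exact_mod_cast hM
  rw [noiseScale_mul_sq hM]
  have e : M * V0 c d ρ * ((1 - ρ) ^ 2 / (M * c ^ 2)) = V0 c d ρ * (1 - ρ) ^ 2 / c ^ 2 := by
    field_simp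
  rw [e, le_div_iff₀ (by positivity)]
  linarith

theorem mul_sum_le_iff {n : ℕ} (hn : 2 ≤ n) (a b : ℝ) (f : ℕ → ℝ) :
    a + b ≤ 1 / ((n : ℝ) - 1) * ∑ i ∈ Finset.Icc 2 n, f i ↔
      ((n - 1 : ℕ) : ℝ) * a + ((n - 1 : ℕ) : ℝ) * b ≤ ∑ i ∈ Finset.range (n - 1), f (i + 2) := by
  have hn' : (2 : ℝ) ≤ n := by exact_mod_cast hn
  have hn1 : 0 < (n : ℝ) - 1 := by linarith
  rw [← sum_Icc_two, Nat.cast_sub (by omega), Nat.cast_one, one_div_mul_eq_div, le_div_iff₀ hn1,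
    ← mul_add, mul_comm]

/-- Deviation of the empirical risk of a fixed matrix. -/
theorem Assumptions.measure_empError_le (h : Assumptions c d ρ n r₀ μ A X ξ ℓ) (hc : 0 < c)
    (hd : 0 < d) (hρ₀ : 0 < ρ) (hρ₁ : ρ < 1) {ℓ' : Vec M → ℝ}
    (hℓ : ∀ x y, |ℓ' x - ℓ' y| ≤ ‖x - y‖) {r : ℕ} (hr : 1 ≤ r) (hq : logRate M n r ≤ 1)
    {Q : Mat M} (hQ : schattenInf Q ≤ ρ) :
    μ {ω | genError μ ℓ' X Q + (1 + ρ) * rankTerm c d ρ M n r ≤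
        empError ℓ' n (fun t => X t ω) Q} ≤
      ENNReal.ofReal (((9 * r * n : ℝ) ^ (7 * (M * r)))⁻¹) := by
  have hM := h.one_le_dim
  have hM' : (0 : ℝ) < M := by exact_mod_cast hM
  have hn := h.two_le hc hd hρ₁
  have hρ : 0 < 1 - ρ := by linarith
  have := h.isProbabilityMeasure_state
  have := h.isProbabilityMeasure_noise
  have hV := V0_pos hc hd hρ₁
  have hd1 := h.noise.one_le hc hd (h.process.measurable_noise 2 le_rfl) hM
  have hch := h.process.stationaryChain
  have hf := pairLipschitz_loss hℓ hρ₀.le h.mem_lowRank.2 hQ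
  -- For q ≤ 1 admissibility is automatic, from V₀(1-ρ)² ≥ 32 c² d and d ≥ 1; no sample-size
  -- condition at rank `r` is used.
  have hadm : 16 * c ^ 2 * logRate M n r ≤ V0 c d ρ * (1 - ρ) ^ 2 := by
    have h1 := V0_ge' hc hd hρ₀ hρ₁
    rw [div_le_iff₀ (by positivity)] at h1
    have h2 : c ^ 2 * logRate M n r ≤ c ^ 2 * 1 := by gcongr
    have h3 : c ^ 2 * 1 ≤ c ^ 2 * d := by gcongr
    have h4 : 0 < c ^ 2 * d := by positivity
    linarith
  -- g = 1 + ρ because (1-ρ) + 2ρ = 1 + ρ. κ = 2 reproduces the rank term 2√(M V₀ q) and gives the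
  -- exponent 4·2 - 1 = 7.
  have key := hf.measure_deviation_le (h.stationaryLaw hc hd hρ₀ hρ₁) hch (κ := 2)
    (g := 1 + ρ) (by positivity) (le_of_eq (by field_simp; ring)) (by linarith) (by positivity)
    (sixteen_mul_noiseScale_le hM hc hd hρ₁) (logRate_pos hM hr hn) (admissible_rate hM hc hadm)
    (n - 1)
  rw [hch.integral_prod_eq hf.measurable] at key
  have e := exp_neg_mul_logRate (M := M) hn hr 7
  norm_num only [Nat.cast_ofNat] at e key
  rw [e] at key
  refine le_trans (measure_mono fun ω hω => ?_) key
  have h1 := (mul_sum_le_iff hn _ _ _).1 hω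
  refine le_trans (le_of_eq ?_) h1
  rw [rankTerm_eq]
  simp only [genError]
  ring

/-- Deviation of the empirical mean of the norms. -/
theorem Assumptions.measure_meanNorm_le (h : Assumptions c d ρ n r₀ μ A X ξ ℓ) (hc : 0 < c)
    (hd : 0 < d) (hρ₀ : 0 < ρ) (hρ₁ : ρ < 1) :
    μ {ω | ∫ ω, ‖X 1 ω‖ ∂μ + 1 / 2 * Real.sqrt (M * V0 c d ρ * logRate M n 1) ≤
        meanNorm n (fun t => X t ω)} ≤ ENNReal.ofReal (((9 * n : ℝ) ^ M)⁻¹) := by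
  have hM := h.one_le_dim
  have hM' : (0 : ℝ) < M := by exact_mod_cast hM
  have hn := h.two_le hc hd hρ₁
  have hρ : 0 < 1 - ρ := by linarith
  have := h.isProbabilityMeasure_state
  have := h.isProbabilityMeasure_noise
  have hV := V0_pos hc hd hρ₁
  have hch := h.process.stationaryChain
  have hf := pairLipschitz_norm A
  have hq0 := logRate_pos hM le_rfl hn
  have hadm : 16 * c ^ 2 * logRate M n 1 ≤ V0 c d ρ * (1 - ρ) ^ 2 := by
    have h1 := h.logRate_one_le hc hd hρ₁
    have h2 : 0 < c ^ 2 * logRate M n 1 := by positivity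
    linarith
  -- κ = 1/2 gives the exponent 1, hence the probability (9n)^{-M}; a larger deviation would not fit
  -- under the scale √(M V₀) used afterwards.
  have key := hf.measure_deviation_le (h.stationaryLaw hc hd hρ₀ hρ₁) hch (κ := 1 / 2)
    (g := 1) one_pos (by simp) le_rfl (by positivity)
    (sixteen_mul_noiseScale_le hM hc hd hρ₁) hq0 (admissible_rate hM hc hadm) (n - 1)
  rw [hch.integral_prod_eq hf.measurable] at key
  have e := exp_neg_mul_logRate (M := M) hn le_rfl 1
  simp only [Nat.cast_one, mul_one, one_mul] at e
  rw [show -(4 * (1 / 2 : ℝ) - 1) = -1 by norm_num, e] at key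
  refine le_trans (measure_mono fun ω hω => ?_) key
  have h1 := (mul_sum_le_iff hn _ _ _).1 hω
  refine le_trans (le_of_eq ?_) h1
  simp only [zero_add, mul_one]

/-- The net consumes 2Mr of the exponent 7Mr; the remaining 5Mr is at least 2M, leaving 9^{-M} for
the union over ranks and (9n)^{-M} for the final probability. -/
theorem net_probability_le {M n r : ℕ} (hr : 1 ≤ r) (hn : 2 ≤ n) {k : ℕ}
    (hk : k ≤ (2 * n + 1) ^ (2 * M * r)) :
    (k : ℝ) * (2 * ((9 * r * n : ℝ) ^ (7 * (M * r)))⁻¹) ≤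
      2 * (((9 : ℝ) ^ M)⁻¹ * ((9 * n : ℝ) ^ M)⁻¹) := by
  have hr' : (1 : ℝ) ≤ r := by exact_mod_cast hr
  have hn' : (2 : ℝ) ≤ n := by exact_mod_cast hn
  have hb : (9 * n : ℝ) ≤ 9 * r * n := by nlinarith
  have h9 : (9 : ℝ) ≤ 9 * n := by linarith
  have hb0 : (0 : ℝ) < 9 * r * n := by linarith
  have hb1 : (1 : ℝ) ≤ 9 * r * n := by linarith
  have hk' : (k : ℝ) ≤ (9 * r * n : ℝ) ^ (2 * M * r) := by
    calc (k : ℝ) ≤ ((2 * n + 1 : ℕ) : ℝ) ^ (2 * M * r) := by exact_mod_cast hk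
      _ ≤ _ := by
        gcongr
        push_cast
        linarith
  have hlow : (9 : ℝ) ^ M * (9 * n : ℝ) ^ M ≤ (9 * r * n : ℝ) ^ (5 * (M * r)) := by
    calc (9 : ℝ) ^ M * (9 * n : ℝ) ^ M ≤ (9 * r * n : ℝ) ^ M * (9 * r * n : ℝ) ^ M := by
          gcongr
          linarith
      _ = (9 * r * n : ℝ) ^ (M + M) := (pow_add _ _ _).symm
      _ ≤ _ := pow_le_pow_right₀ hb1 (by nlinarith [Nat.zero_le M])
  calc (k : ℝ) * (2 * ((9 * r * n : ℝ) ^ (7 * (M * r)))⁻¹)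
      ≤ (9 * r * n : ℝ) ^ (2 * M * r) * (2 * ((9 * r * n : ℝ) ^ (7 * (M * r)))⁻¹) := by gcongr
    _ = 2 * ((9 * r * n : ℝ) ^ (5 * (M * r)))⁻¹ := by
        rw [show 7 * (M * r) = 2 * M * r + 5 * (M * r) by ring, pow_add, mul_inv]
        field_simp
    _ ≤ 2 * ((9 : ℝ) ^ M * (9 * n : ℝ) ^ M)⁻¹ := by gcongr
    _ = _ := by rw [mul_inv]

theorem measurable_empError {ℓ' : Vec M → ℝ} (hℓ : ∀ x y, |ℓ' x - ℓ' y| ≤ ‖x - y‖)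
    (hX : ∀ t, 1 ≤ t → Measurable (X t)) (Q : Mat M) :
    Measurable fun ω => empError ℓ' n (fun t => X t ω) Q := by
  unfold empError
  refine Measurable.const_mul (Finset.measurable_fun_sum _ fun i hi => ?_) _
  have hi2 := (Finset.mem_Icc.1 hi).1
  exact (continuous_loss hℓ).measurable.comp ((hX i (by omega)).sub
    ((continuous_act Q).measurable.comp (hX (i - 1) (by omega))))

theorem measurable_meanNorm (hX : ∀ t, 1 ≤ t → Measurable (X t)) :
    Measurable fun ω => meanNorm n (fun t => X t ω) := by
  unfold meanNorm
  refine Measurable.const_mul (Finset.measurable_fun_sum _ fun i hi => ?_) _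
  have hi2 := (Finset.mem_Icc.1 hi).1
  exact (hX (i - 1) (by omega)).norm

theorem empError_neg (ℓ : Vec M → ℝ) (n : ℕ) (x : ℕ → Vec M) (Q : Mat M) :
    empError (fun v => -ℓ v) n x Q = -empError ℓ n x Q := by
  simp [empError]

omit [IsProbabilityMeasure μ] in
theorem genError_neg (ℓ : Vec M → ℝ) (X : ℕ → Ω → Vec M) (Q : Mat M) :
    genError μ (fun v => -ℓ v) X Q = -genError μ ℓ X Q := by
  simp [genError, integral_neg]

/-- Simultaneous deviations over finite nets of all the classes `𝓜(ρ, r)`. -/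
theorem Assumptions.exists_event_net (h : Assumptions c d ρ n r₀ μ A X ξ ℓ) (hc : 0 < c)
    (hd : 0 < d) (hρ₀ : 0 < ρ) (hρ₁ : ρ < 1) (T : ℕ → Finset (Mat M))
    (hT : ∀ r, ∀ Q ∈ T r, Q ∈ lowRank M ρ r)
    (hcard : ∀ r, (T r).card ≤ (2 * n + 1) ^ (2 * M * r)) :
    WithProbAtLeast μ (1 - ((n : ℝ) ^ M)⁻¹) fun ω =>
      meanNorm n (fun t => X t ω) ≤
        ∫ ω, ‖X 1 ω‖ ∂μ + 1 / 2 * Real.sqrt (M * V0 c d ρ * logRate M n 1) ∧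
      ∀ r ∈ Set.Icc 1 M, logRate M n r ≤ 1 → ∀ Q ∈ T r,
        |genError μ ℓ X Q - empError ℓ n (fun t => X t ω) Q| ≤
          (1 + ρ) * rankTerm c d ρ M n r := by
  classical
  have hM := h.one_le_dim
  have hM' : (0 : ℝ) < M := by exact_mod_cast hM
  have hn := h.two_le hc hd hρ₁
  have hn' : (2 : ℝ) ≤ n := by exact_mod_cast hn
  have hℓ := h.loss_abs_sub_le
  -- Lower deviations are upper deviations for the loss -ℓ.
  have hℓn : ∀ x y, |(fun v => -ℓ v) x - (fun v => -ℓ v) y| ≤ ‖x - y‖ := by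
    intro x y
    simp only
    rw [← abs_neg, show -(-ℓ x - -ℓ y) = ℓ x - ℓ y by ring]
    exact hℓ x y
  have hX := h.process.measurable_X
  set B₀ := {ω | ∫ ω, ‖X 1 ω‖ ∂μ + 1 / 2 * Real.sqrt (M * V0 c d ρ * logRate M n 1) ≤
        meanNorm n (fun t => X t ω)} with hB₀
  let B : (Vec M → ℝ) → ℕ → Mat M → Set Ω := fun ℓ' r Q =>
    {ω | genError μ ℓ' X Q + (1 + ρ) * rankTerm c d ρ M n r ≤ empError ℓ' n (fun t => X t ω) Q}
  have hBm : ∀ (ℓ' : Vec M → ℝ), (∀ x y, |ℓ' x - ℓ' y| ≤ ‖x - y‖) → ∀ r Q,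
      MeasurableSet (B ℓ' r Q) := fun ℓ' hℓ' r Q =>
    measurableSet_le measurable_const (measurable_empError hℓ' hX Q)
  set R := (Finset.Icc 1 M).filter fun r => logRate M n r ≤ 1 with hR
  set N : ℕ → Set Ω := fun r => ⋃ Q ∈ T r, (B ℓ r Q ∪ B (fun v => -ℓ v) r Q) with hN
  have hNm : ∀ r, MeasurableSet (N r) := fun r =>
    Finset.measurableSet_biUnion _ fun Q _ => (hBm ℓ hℓ r Q).union (hBm _ hℓn r Q)
  set ε : ℝ := ((9 * n : ℝ) ^ M)⁻¹ with hε
  have hε0 : 0 ≤ ε := by positivity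
  have hNμ : ∀ r ∈ R, μ (N r) ≤ ENNReal.ofReal (2 * (((9 : ℝ) ^ M)⁻¹ * ε)) := by
    intro r hr
    obtain ⟨hr1, hrq⟩ := Finset.mem_filter.1 hr
    have hr1 := (Finset.mem_Icc.1 hr1).1
    set δ : ℝ := ((9 * r * n : ℝ) ^ (7 * (M * r)))⁻¹ with hδ
    have hδ0 : 0 ≤ δ := by positivity
    calc μ (N r) ≤ ∑ Q ∈ T r, μ (B ℓ r Q ∪ B (fun v => -ℓ v) r Q) := measure_biUnion_finset_le _ _
      _ ≤ ∑ _Q ∈ T r, ENNReal.ofReal (2 * δ) := by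
          refine Finset.sum_le_sum fun Q hQ => (measure_union_le _ _).trans ?_
          rw [two_mul, ENNReal.ofReal_add hδ0 hδ0]
          exact add_le_add
            (h.measure_empError_le hc hd hρ₀ hρ₁ hℓ hr1 hrq (hT r Q hQ).2)
            (h.measure_empError_le hc hd hρ₀ hρ₁ hℓn hr1 hrq (hT r Q hQ).2)
      _ = ENNReal.ofReal ((T r).card * (2 * δ)) := by
          rw [Finset.sum_const, nsmul_eq_mul, ENNReal.ofReal_mul (Nat.cast_nonneg _),
            ENNReal.ofReal_natCast]
      _ ≤ _ := ENNReal.ofReal_le_ofReal (net_probability_le hr1 hn (hcard r))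
  have hbad : μ (B₀ ∪ ⋃ r ∈ R, N r) ≤ ENNReal.ofReal (((n : ℝ) ^ M)⁻¹) := by
    calc μ (B₀ ∪ ⋃ r ∈ R, N r) ≤ μ B₀ + ∑ r ∈ R, μ (N r) :=
          (measure_union_le _ _).trans (add_le_add le_rfl (measure_biUnion_finset_le _ _))
      _ ≤ ENNReal.ofReal ε + ∑ _r ∈ R, ENNReal.ofReal (2 * (((9 : ℝ) ^ M)⁻¹ * ε)) :=
          add_le_add (h.measure_meanNorm_le hc hd hρ₀ hρ₁) (Finset.sum_le_sum hNμ)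
      _ = ENNReal.ofReal (ε + R.card * (2 * (((9 : ℝ) ^ M)⁻¹ * ε))) := by
          rw [Finset.sum_const, nsmul_eq_mul, ENNReal.ofReal_add hε0 (by positivity),
            ENNReal.ofReal_mul (Nat.cast_nonneg _), ENNReal.ofReal_natCast]
      _ ≤ _ := by
          apply ENNReal.ofReal_le_ofReal
          -- The at most M ≤ 9^M ranks contribute 2ε in total, so the bad event has probability at
          -- most 3ε, while 9ε ≤ n^{-M}.
          have h9M : (M : ℝ) ≤ 9 ^ M := by
            exact_mod_cast (Nat.lt_pow_self (by norm_num : 1 < 9)).le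
          have hRc : (R.card : ℝ) ≤ 9 ^ M := by
            refine le_trans ?_ h9M
            have : R.card ≤ M := (Finset.card_filter_le _ _).trans (by simp)
            exact_mod_cast this
          have e1 : (9 : ℝ) ^ M * (2 * (((9 : ℝ) ^ M)⁻¹ * ε)) = 2 * ε := by
            field_simp
          have e2 : (R.card : ℝ) * (2 * (((9 : ℝ) ^ M)⁻¹ * ε)) ≤ 2 * ε := by
            rw [← e1]; gcongr
          have h3 : (9 : ℝ) ≤ 9 ^ M := le_self_pow₀ (by norm_num) (by omega)
          have e3 : 9 * ε ≤ ((n : ℝ) ^ M)⁻¹ := by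
            rw [hε, mul_pow, mul_inv, ← mul_assoc]
            refine mul_le_of_le_one_left (by positivity) ?_
            rw [← div_eq_mul_inv, div_le_one (by positivity)]
            exact h3
          linarith
  have hmeas : MeasurableSet (B₀ ∪ ⋃ r ∈ R, N r) :=
    (measurableSet_le measurable_const (measurable_meanNorm hX)).union
      (Finset.measurableSet_biUnion _ fun r _ => hNm r)
  refine ⟨(B₀ ∪ ⋃ r ∈ R, N r)ᶜ, hmeas.compl, ?_, ?_⟩
  · rw [prob_compl_eq_one_sub hmeas, ENNReal.ofReal_sub _ (by positivity), ENNReal.ofReal_one]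
    exact tsub_le_tsub_left hbad 1
  · intro ω hω
    rw [Set.mem_compl_iff, Set.mem_union, not_or] at hω
    refine ⟨(not_le.1 hω.1).le, fun r hr hrq Q hQ => ?_⟩
    have h1 : ω ∉ B ℓ r Q ∪ B (fun v => -ℓ v) r Q := fun hmem => hω.2 <|
      Set.mem_biUnion (x := r) (Finset.mem_filter.2 ⟨Finset.mem_Icc.2 hr, hrq⟩)
        (Set.mem_biUnion hQ hmem)
    rw [Set.mem_union, not_or] at h1
    have h2 : empError ℓ n (fun t => X t ω) Q <
        genError μ ℓ X Q + (1 + ρ) * rankTerm c d ρ M n r := lt_of_not_ge h1.1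
    have h3 : empError (fun v => -ℓ v) n (fun t => X t ω) Q <
        genError μ (fun v => -ℓ v) X Q + (1 + ρ) * rankTerm c d ρ M n r := lt_of_not_ge h1.2
    rw [empError_neg, genError_neg] at h3
    rw [abs_le]
    constructor <;> linarith

/-- The mesh of the net is below the statistical rate, because log(9rn) ≥ 1 and n - 1 ≤ n². -/
theorem sqrt_div_le_sqrt_logRate {M n r : ℕ} (hr : 1 ≤ r) (hn : 2 ≤ n) :
    Real.sqrt (M * r) / n ≤ Real.sqrt (logRate M n r) := by
  have hn' : (2 : ℝ) ≤ n := by exact_mod_cast hn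
  have hn1 : 0 < (n : ℝ) - 1 := by linarith
  have hl := one_le_log hr (by omega : 1 ≤ n)
  apply Real.le_sqrt_of_sq_le
  rw [div_pow, Real.sq_sqrt (by positivity), logRate]
  refine div_le_div₀ (by positivity) ?_ hn1 (by nlinarith)
  exact le_mul_of_one_le_right (by positivity) hl

/-- Simultaneous comparison of the risk and the empirical risk on all the classes `𝓜(ρ, r)`. -/
theorem Assumptions.exists_event (h : Assumptions c d ρ n r₀ μ A X ξ ℓ) (hc : 0 < c)
    (hd : 0 < d) (hρ₀ : 0 < ρ) (hρ₁ : ρ < 1) :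
    WithProbAtLeast μ (1 - ((n : ℝ) ^ M)⁻¹) fun ω =>
      ∀ r ∈ Set.Icc 1 M, ∀ r' ∈ Set.Icc 1 M, ∀ Q ∈ lowRank M ρ r, ∀ Q' ∈ lowRank M ρ r',
        (genError μ ℓ X Q - empError ℓ n (fun t => X t ω) Q) -
          (genError μ ℓ X Q' - empError ℓ n (fun t => X t ω) Q') ≤
        2 * (1 + ρ) * (rankTerm c d ρ M n r + rankTerm c d ρ M n r') := by
  have hM := h.one_le_dim
  have hn := h.two_le hc hd hρ₁
  have hn' : (2 : ℝ) ≤ n := by exact_mod_cast hn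
  have hV := V0_pos hc hd hρ₁
  choose T hT hcard hnet using fun r =>
    exists_net (M := M) hρ₀.le hρ₁.le r (n := n) (by omega)
  obtain ⟨E, hE, hEμ, hEω⟩ := h.exists_event_net hc hd hρ₀ hρ₁ T hT hcard
  refine ⟨E, hE, hEμ, fun ω hω => ?_⟩
  obtain ⟨hmean, hdev⟩ := hEω ω hω
  set x : ℕ → Vec M := fun t => X t ω
  set m := ∫ ω, ‖X 1 ω‖ ∂μ
  set S := Real.sqrt (M * V0 c d ρ) with hS
  have hS0 : 0 ≤ S := Real.sqrt_nonneg _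
  have hsqrt : ∀ q, Real.sqrt (M * V0 c d ρ * q) = S * Real.sqrt q := fun q =>
    Real.sqrt_mul (by positivity) q
  have hrt : ∀ r, rankTerm c d ρ M n r = 2 * (S * Real.sqrt (logRate M n r)) := fun r => by
    rw [rankTerm_eq, hsqrt]
  have hm : m ≤ S / 4 := h.integral_norm_le hc hd hρ₀ hρ₁
  have hm0 : 0 ≤ m := integral_nonneg fun _ => norm_nonneg _
  have hb0 : 0 ≤ meanNorm n x := meanNorm_nonneg hn x
  rw [hsqrt] at hmean
  have hsum : m + meanNorm n x ≤ S * ((1 + Real.sqrt (logRate M n 1)) / 2) := by linarith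
  have hlip : ∀ Q Q' : Mat M, |(genError μ ℓ X Q - empError ℓ n x Q) -
      (genError μ ℓ X Q' - empError ℓ n x Q')| ≤ schattenInf (Q - Q') * (m + meanNorm n x) := by
    intro Q Q'
    have h1 := h.abs_genError_sub_le hc hd hρ₀ hρ₁ Q Q'
    have h2 := abs_empError_sub_le h.loss_abs_sub_le hn x Q Q'
    rw [sub_sub_sub_comm]
    refine (abs_sub _ _).trans ?_
    rw [mul_add]
    exact add_le_add h1 h2
  -- When q > 1 the rank term is at least of the order √(M V₀) of the Lipschitz bound over the whole
  -- ball of radius ρ, so no concentration over the class is needed.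
  have hlarge : ∀ r, 1 ≤ r → 1 < logRate M n r → ∀ Q Q' : Mat M, schattenInf Q ≤ ρ →
      schattenInf Q' ≤ ρ → (genError μ ℓ X Q - empError ℓ n x Q) -
      (genError μ ℓ X Q' - empError ℓ n x Q') ≤ 2 * (1 + ρ) * rankTerm c d ρ M n r := by
    intro r hr hq Q Q' hQ hQ'
    refine (le_abs_self _).trans ((hlip Q Q').trans ?_)
    have h1 : 1 ≤ Real.sqrt (logRate M n r) := Real.one_le_sqrt.2 hq.le
    have h2 : Real.sqrt (logRate M n 1) ≤ Real.sqrt (logRate M n r) :=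
      Real.sqrt_le_sqrt (logRate_mono hn le_rfl hr)
    have h3 : m + meanNorm n x ≤ S * Real.sqrt (logRate M n r) :=
      hsum.trans (mul_le_mul_of_nonneg_left (by linarith) hS0)
    have h4 : schattenInf (Q - Q') ≤ 2 * ρ := by linarith [schattenInf_sub_le Q Q']
    calc schattenInf (Q - Q') * (m + meanNorm n x)
        ≤ 2 * ρ * (S * Real.sqrt (logRate M n r)) :=
          mul_le_mul h4 h3 (by positivity) (by positivity)
      _ ≤ 2 * (1 + ρ) * (2 * (S * Real.sqrt (logRate M n r))) := by
          have : 0 ≤ S * Real.sqrt (logRate M n r) := by positivity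
          nlinarith
      _ = _ := by rw [hrt]
  -- When q ≤ 1, one half of the bound pays for the deviation at a net point and the other half for
  -- the distance to it.
  have hsmall : ∀ r ∈ Set.Icc 1 M, logRate M n r ≤ 1 → ∀ Q ∈ lowRank M ρ r,
      |genError μ ℓ X Q - empError ℓ n x Q| ≤ 2 * (1 + ρ) * rankTerm c d ρ M n r := by
    intro r hr hq Q hQ
    obtain ⟨Q₁, hQ₁, hQQ⟩ := hnet r Q hQ
    have h1 := hdev r hr hq Q₁ hQ₁
    have h2 := hlip Q Q₁
    have h3 : Real.sqrt (logRate M n 1) ≤ 1 :=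
      Real.sqrt_le_one.2 ((logRate_mono hn le_rfl hr.1).trans hq)
    have h4 : m + meanNorm n x ≤ S := hsum.trans (mul_le_of_le_one_right hS0 (by linarith))
    have h5 := sqrt_div_le_sqrt_logRate (M := M) hr.1 hn
    have h6 : schattenInf (Q - Q₁) * (m + meanNorm n x) ≤ (1 + ρ) * rankTerm c d ρ M n r := by
      calc schattenInf (Q - Q₁) * (m + meanNorm n x)
          ≤ (2 * Real.sqrt (M * r) / n) * S := mul_le_mul hQQ h4 (by positivity) (by positivity)
        _ = 2 * (Real.sqrt (M * r) / n) * S := by ring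
        _ ≤ 2 * Real.sqrt (logRate M n r) * S := by gcongr
        _ = rankTerm c d ρ M n r := by rw [hrt]; ring
        _ ≤ _ := le_mul_of_one_le_left (rankTerm_nonneg _ _ _ _ _ _) (by linarith)
    have h7 := abs_sub_abs_le_abs_sub (genError μ ℓ X Q - empError ℓ n x Q)
      (genError μ ℓ X Q₁ - empError ℓ n x Q₁)
    linarith
  intro r hr r' hr' Q hQ Q' hQ'
  -- If either rank has q > 1, its term alone bounds the difference for both matrices; otherwise
  -- both ranks use the net.
  have hp : 0 ≤ 2 * (1 + ρ) * rankTerm c d ρ M n r :=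
    mul_nonneg (by positivity) (rankTerm_nonneg _ _ _ _ _ _)
  have hp' : 0 ≤ 2 * (1 + ρ) * rankTerm c d ρ M n r' :=
    mul_nonneg (by positivity) (rankTerm_nonneg _ _ _ _ _ _)
  rw [mul_add]
  rcases lt_or_ge 1 (logRate M n r) with hq | hq
  · linarith [hlarge r hr.1 hq Q Q' hQ.2 hQ'.2]
  · rcases lt_or_ge 1 (logRate M n r') with hq' | hq'
    · linarith [hlarge r' hr'.1 hq' Q Q' hQ.2 hQ'.2]
    · have h1 := abs_le.1 (hsmall r hr hq Q hQ)
      have h2 := abs_le.1 (hsmall r' hr' hq' Q' hQ')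
      linarith [h1.2, h2.1]

end Deviations

/-! ### The oracle inequality -/

section Oracle

variable {c d ρ : ℝ} {M n r₀ : ℕ} {Ω : Type*} [MeasurableSpace Ω] {μ : Measure Ω}
  [IsProbabilityMeasure μ] {A : Mat M} {X ξ : ℕ → Ω → Vec M} {ℓ : Vec M → ℝ}

omit [IsProbabilityMeasure μ] in
theorem Assumptions.mem_Icc_dim (h : Assumptions c d ρ n r₀ μ A X ξ ℓ) (hc : 0 < c)
    (hd : 0 < d) (hρ₁ : ρ < 1) {r : ℕ} (hr : r ∈ Set.Icc 1 (rbar c d ρ M n)) :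
    r ∈ Set.Icc 1 M :=
  ⟨hr.1, hr.2.trans (h.rbar_set_nonempty hc hd hρ₁).2⟩

/-- With probability at least `1 - n^{-M}`, the rank-penalized estimator satisfies the oracle
inequality with no remainder term, against every competitor of rank at most `r̄`. -/
theorem Assumptions.oracle_inequality (h : Assumptions c d ρ n r₀ μ A X ξ ℓ) (hc : 0 < c)
    (hd : 0 < d) (hρ₀ : 0 < ρ) (hρ₁ : ρ < 1) {Ahat : Ω → Mat M}
    (hA : IsRankPenalizedEstimator c d ρ ℓ n X Ahat) :
    WithProbAtLeast μ (1 - ((n : ℝ) ^ M)⁻¹) fun ω =>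
      ∀ r ∈ Set.Icc 1 (rbar c d ρ M n), ∀ Q ∈ lowRank M ρ r,
        genError μ ℓ X (Ahat ω) ≤ genError μ ℓ X Q + 4 * (1 + ρ) * rankTerm c d ρ M n r := by
  obtain ⟨E, hE, hEμ, hEω⟩ := h.exists_event hc hd hρ₀ hρ₁
  refine ⟨E, hE, hEμ, fun ω hω r hr Q hQ => ?_⟩
  obtain ⟨B, s, hB, hs, hmin, hAB⟩ := hA ω
  rw [hAB]
  -- The term 2(1+ρ) times the rank term of the selected rank is exactly its penalty and cancels;
  -- the competitor pays once for its penalty and once for its deviation, which gives the factor 4.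
  have h1 := hEω ω hω s (h.mem_Icc_dim hc hd hρ₁ hs) r (h.mem_Icc_dim hc hd hρ₁ hr)
    (B s) (hB s hs).1 Q hQ
  have h2 := hmin r hr
  have h3 := (hB r hr).2 Q hQ
  rw [mul_add] at h1
  linarith

theorem Assumptions.exists_oracle (h : Assumptions c d ρ n r₀ μ A X ξ ℓ) (hc : 0 < c)
    (hd : 0 < d) (hρ₀ : 0 < ρ) (hρ₁ : ρ < 1) :
    ∃ r ∈ Set.Icc 1 (rbar c d ρ M n), ∃ Q ∈ lowRank M ρ r,
      oracleBound μ ℓ X c d ρ n = genError μ ℓ X Q + 4 * (1 + ρ) * rankTerm c d ρ M n r := by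
  obtain ⟨r, hr, hre⟩ := (isLeast_oracleBound (μ := μ) (ℓ := ℓ) (X := X) c d ρ n
    (h.rbar_set_nonempty hc hd hρ₁).1).1
  obtain ⟨Q, hQ, hQe⟩ := (h.exists_minimizer hc hd hρ₀ hρ₁ r).1
  exact ⟨r, hr, Q, hQ, by rw [hQe, ← hre]⟩

/-- The crude bound on the excess risk that holds for every matrix of norm at most `ρ`. -/
theorem Assumptions.genError_le_oracleBound_add (h : Assumptions c d ρ n r₀ μ A X ξ ℓ)
    (hc : 0 < c) (hd : 0 < d) (hρ₀ : 0 < ρ) (hρ₁ : ρ < 1) {Q : Mat M} (hQ : schattenInf Q ≤ ρ) :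
    genError μ ℓ X Q ≤ oracleBound μ ℓ X c d ρ n + Real.sqrt (M * V0 c d ρ) / 2 := by
  obtain ⟨r, -, Q', hQ', hO⟩ := h.exists_oracle hc hd hρ₀ hρ₁
  have h1 := (le_abs_self _).trans (h.abs_genError_sub_le hc hd hρ₀ hρ₁ Q Q')
  have h2 := h.integral_norm_le hc hd hρ₀ hρ₁
  have h3 : schattenInf (Q - Q') ≤ 2 := by linarith [schattenInf_sub_le Q Q', hQ'.2]
  have h4 : schattenInf (Q - Q') * ∫ ω, ‖X 1 ω‖ ∂μ ≤ 2 * (Real.sqrt (M * V0 c d ρ) / 4) :=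
    mul_le_mul h3 h2 (integral_nonneg fun _ => norm_nonneg _) (by norm_num)
  have h5 : 0 ≤ 4 * (1 + ρ) * rankTerm c d ρ M n r :=
    mul_nonneg (by positivity) (rankTerm_nonneg _ _ _ _ _ _)
  linarith

end Oracle

end LowRankVAR

end

/-! ### The two forms of the theorem -/

theorem mainTheorem4 (c d ρ : ℝ) (hc : 0 < c) (hd : 0 < d) (hρ₀ : 0 < ρ) (hρ₁ : ρ < 1) :
    -- the case `η = n^{-M}`
    (∃ D₅ : ℝ, 0 < D₅ ∧
      ∀ (M n r₀ : ℕ) (Ω : Type*) [MeasurableSpace Ω] (μ : Measure Ω) [IsProbabilityMeasure μ]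
        (A : LowRankVAR.Mat M) (X ξ : ℕ → Ω → LowRankVAR.Vec M) (ℓ : LowRankVAR.Vec M → ℝ),
        LowRankVAR.Assumptions c d ρ n r₀ μ A X ξ ℓ →
        -- the risk is well defined and independent of `t`, and the minima are attained
        (∀ (Q : LowRankVAR.Mat M) (t : ℕ), 2 ≤ t →
          Integrable (fun ω => ℓ (X t ω - LowRankVAR.act Q (X (t - 1) ω))) μ ∧
          ∫ ω, ℓ (X t ω - LowRankVAR.act Q (X (t - 1) ω)) ∂μ = LowRankVAR.genError μ ℓ X Q) ∧
        (∀ r ∈ Set.Icc 1 (LowRankVAR.rbar c d ρ M n),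
          IsLeast (LowRankVAR.genError μ ℓ X '' LowRankVAR.lowRank M ρ r)
            (LowRankVAR.minRisk μ ℓ X ρ r)) ∧
        IsLeast (LowRankVAR.oracleValues μ ℓ X c d ρ n)
          (LowRankVAR.oracleBound μ ℓ X c d ρ n) ∧
        -- the oracle inequality and its adaptive form
        ∀ Ahat : Ω → LowRankVAR.Mat M,
          LowRankVAR.IsRankPenalizedEstimator c d ρ ℓ n X Ahat →
          LowRankVAR.WithProbAtLeast μ (1 - ((n : ℝ) ^ M)⁻¹) (fun ω =>
            LowRankVAR.genError μ ℓ X (Ahat ω) ≤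
              LowRankVAR.oracleBound μ ℓ X c d ρ n +
                D₅ * Real.log M * Real.sqrt ((M : ℝ) ^ 2 * Real.log n / n) ∧
            (r₀ ≤ LowRankVAR.rbar c d ρ M n →
              LowRankVAR.genError μ ℓ X (Ahat ω) ≤
                LowRankVAR.genError μ ℓ X A +
                  4 * (1 + ρ) * LowRankVAR.rankTerm c d ρ M n r₀ +
                  D₅ * Real.log M * Real.sqrt ((M : ℝ) ^ 2 * Real.log n / n)))) ∧
    -- the case of a fixed `η`
    (∀ η : ℝ, 0 < η → ∃ D₃ D₄ : ℝ, 0 < D₃ ∧ 0 < D₄ ∧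
      ∀ (M n r₀ : ℕ) (Ω : Type*) [MeasurableSpace Ω] (μ : Measure Ω) [IsProbabilityMeasure μ]
        (A : LowRankVAR.Mat M) (X ξ : ℕ → Ω → LowRankVAR.Vec M) (ℓ : LowRankVAR.Vec M → ℝ),
        LowRankVAR.Assumptions c d ρ n r₀ μ A X ξ ℓ →
        ∀ Ahat : Ω → LowRankVAR.Mat M,
          LowRankVAR.IsRankPenalizedEstimator c d ρ ℓ n X Ahat →
          LowRankVAR.WithProbAtLeast μ (1 - η) (fun ω =>
            LowRankVAR.genError μ ℓ X (Ahat ω) ≤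
              LowRankVAR.oracleBound μ ℓ X c d ρ n +
                D₃ * Real.sqrt (Real.log M ^ 2 / (n * Real.log n)) +
                D₄ * (Real.sqrt M / n))) := by
  have hlogM : ∀ M : ℕ, 1 ≤ M → 0 ≤ Real.log M := fun M hM =>
    Real.log_nonneg (by exact_mod_cast hM)
  -- D₅ = D₃ = 1 are arbitrary positive values. D₄ is the crude excess-risk constant √V₀/2 divided
  -- by η.
  refine ⟨⟨1, one_pos, ?_⟩, fun η hη => ⟨1, Real.sqrt (LowRankVAR.V0 c d ρ) / (2 * η),
    one_pos, by have := LowRankVAR.V0_pos hc hd hρ₁; positivity, ?_⟩⟩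
  · intro M n r₀ Ω _ μ _ A X ξ ℓ h
    have hrem : 0 ≤ 1 * Real.log M * Real.sqrt ((M : ℝ) ^ 2 * Real.log n / n) :=
      mul_nonneg (mul_nonneg zero_le_one (hlogM M h.one_le_dim)) (Real.sqrt_nonneg _)
    refine ⟨fun Q t ht => ⟨h.integrable_loss hc hd hρ₀ hρ₁ Q ht, h.integral_loss_eq Q ht⟩,
      fun r _ => h.exists_minimizer hc hd hρ₀ hρ₁ r,
      LowRankVAR.isLeast_oracleBound c d ρ n (h.rbar_set_nonempty hc hd hρ₁).1,
      fun Ahat hA => ?_⟩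
    obtain ⟨E, hE, hEμ, hEω⟩ := h.oracle_inequality hc hd hρ₀ hρ₁ hA
    refine ⟨E, hE, hEμ, fun ω hω => ⟨?_, fun hr₀ => ?_⟩⟩
    · obtain ⟨r, hr, Q, hQ, hO⟩ := h.exists_oracle hc hd hρ₀ hρ₁
      have := hEω ω hω r hr Q hQ
      linarith
    · have := hEω ω hω r₀ ⟨h.rank_range.1, hr₀⟩ A h.mem_lowRank
      linarith
  · intro M n r₀ Ω _ μ _ A X ξ ℓ h Ahat hA
    have hn : (2 : ℝ) ≤ n := by exact_mod_cast h.two_le hc hd hρ₁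
    have hrem₃ : 0 ≤ 1 * Real.sqrt (Real.log M ^ 2 / (n * Real.log n)) := by positivity
    -- If n^{-M} ≤ η the first event is already likely enough. Otherwise η n ≤ 1, and the crude
    -- bound √(M V₀)/2 is at most D₄ √M / n on the whole space.
    rcases le_or_gt ((n : ℝ) ^ M)⁻¹ η with hnη | hnη
    · obtain ⟨E, hE, hEμ, hEω⟩ := h.oracle_inequality hc hd hρ₀ hρ₁ hA
      refine ⟨E, hE, le_trans (ENNReal.ofReal_le_ofReal (by linarith)) hEμ, fun ω hω => ?_⟩
      obtain ⟨r, hr, Q, hQ, hO⟩ := h.exists_oracle hc hd hρ₀ hρ₁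
      have := hEω ω hω r hr Q hQ
      have hrem₄ : 0 ≤ Real.sqrt (LowRankVAR.V0 c d ρ) / (2 * η) * (Real.sqrt M / n) := by
        positivity
      linarith
    · refine ⟨Set.univ, MeasurableSet.univ, ?_, fun ω _ => ?_⟩
      · rw [measure_univ, ENNReal.ofReal_le_one]
        linarith
      · obtain ⟨B, s, hB, hs, -, hAB⟩ := hA ω
        have h1 := h.genError_le_oracleBound_add hc hd hρ₀ hρ₁ (Q := Ahat ω)
          (by rw [hAB]; exact (hB s hs).1.2)
        have hnM : (n : ℝ) ≤ (n : ℝ) ^ M :=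
          le_self_pow₀ (by linarith) (by have := h.one_le_dim; omega)
        have hη1 : η * n ≤ 1 := by
          have h2 : ((n : ℝ) ^ M)⁻¹ ≤ (n : ℝ)⁻¹ := by gcongr
          have h3 : η ≤ (n : ℝ)⁻¹ := hnη.le.trans h2
          calc η * n ≤ (n : ℝ)⁻¹ * n := by gcongr
            _ = 1 := by field_simp
        have h4 : Real.sqrt (M * LowRankVAR.V0 c d ρ) / 2 ≤
            Real.sqrt (LowRankVAR.V0 c d ρ) / (2 * η) * (Real.sqrt M / n) := by
          rw [Real.sqrt_mul (Nat.cast_nonneg M), div_mul_div_comm,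
            mul_comm (Real.sqrt (LowRankVAR.V0 c d ρ))]
          gcongr
          rw [mul_assoc]
          linarith
        linarith
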